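/- Let $k,d\ge 1$ and let $P$ be a probability measure on $\mathbb{R}^d$ with bounded support that admits a bounded, continuous density with respect to Lebesgue measure. Assume that $\mu^*=(\mu_1^*,\dots,\mu_k^*)\in(\mathbb{R}^d)^k$ is the unique minimizer (up to relabelling of the centers) of the population $k$-means functional $\mu\mapsto\int\min_{j\le k}\|x-\mu_j\|^2\,dP(x)$. For $\mu=(\mu_1,\dots,\mu_k)\in(\mathbb{R}^d)^k$ let $C_1(\mu),\dots,C_k(\mu)$ be the partition of $\mathbb{R}^d$ into Voronoi cells, where $C_j(\mu)$ is the set of points whose nearest center is $\mu_j$ (ties go to the smallest index), and define $h_\mu:\mathbb{R}^d\to\mathbb{R}^{k-1}$ by $h_\mu(x)=e_l$ if $x\in C_l(\mu)$ with $l\le k-1$, and $h_\mu(x)=\mathbf 0$ if $x\in C_k(\mu)$, where $e_1,\dots,e_{k-1}$ are the canonical vectors of $\mathbb{R}^{k-1}$. Then for every compact neighborhood $\mathcal K$ of $\mu^*$ of sufficiently small diameter (that is, there is $\delta>0$, depending on $P$ and $\mu^*$, such that the following holds for every compact neighborhood $\mathcal K$ of $\mu^*$ with diameter at most $\delta$),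 the class $\mathcal H=\{h_\mu:\mu\in\mathcal K\}$ has the following two properties. (i) $\mathcal H$ is $P$-Donsker: for $X_1,X_2,\dots$ i.i.d. with law $P$, the empirical processes $h\mapsto\sqrt n\,\bigl(\frac1n\sum_{i=1}^n h(X_i)-\int h\,dP\bigr)$, $h\in\mathcal H$, converge in distribution (in the sense of outer expectations of bounded continuous functions) in the space $\ell^\infty(\mathcal H)$ of bounded functions $\mathcal H\to\mathbb{R}^{k-1}$ to a tight Borel law. (ii) There is a constant $A>0$ such that for all $\varepsilon\in(0,1]$ the $L^2(P)$ covering number $N_2(\varepsilon,\mathcal H,P)$, the smallest number of closed $L^2(P)$-balls of radius $\varepsilon$ with centers in $\mathcal H$ that cover $\mathcal H$, satisfies $$N_2(\varepsilon,\mathcal H,P)\le A\left(\frac1\varepsilon\right)^{2kd}.$$ -/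

import Mathlib

open MeasureTheory Filter Topology
open scoped ENNReal NNReal BoundedContinuousFunction

noncomputable section

/-! ### Voronoi cells and the `k`-means functional -/

/-- The Voronoi cells of the centers `μ 0, …, μ (k-1)`: a point belongs to the cell of its nearest
center, and a point with several nearest centers to the one with the smallest index, so that the
cells form a partition of `ℝ^d`. -/
def voronoiCell {k d : ℕ} (μ : Fin k → EuclideanSpace ℝ (Fin d)) (j : Fin k) :
    Set (EuclideanSpace ℝ (Fin d)) :=
  {x | (∀ l, dist x (μ j) ≤ dist x (μ l)) ∧ ∀ l, l < j → dist x (μ j) < dist x (μ l)}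

open Classical in
/-- The function `h_μ : ℝ^d → ℝ^(k-1)`: it equals the `l`-th canonical vector on the `l`-th cell,
for each `l` among the first `k - 1` indices, and the zero vector on the last cell. -/
def cellIndicator {k d : ℕ} (μ : Fin k → EuclideanSpace ℝ (Fin d))
    (x : EuclideanSpace ℝ (Fin d)) : EuclideanSpace ℝ (Fin (k - 1)) :=
  WithLp.toLp 2 fun l => if x ∈ voronoiCell μ (Fin.castLE (Nat.sub_le k 1) l) then 1 else 0

/-- The class `{h_μ : μ ∈ K}`. -/
def cellClass {k d : ℕ} (K : Set (Fin k → EuclideanSpace ℝ (Fin d))) :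
    Set (EuclideanSpace ℝ (Fin d) → EuclideanSpace ℝ (Fin (k - 1))) :=
  cellIndicator '' K

/-- The population `k`-means functional `∫ min_j ‖x - μ_j‖² dP(x)`. -/
def kMeansRisk {k d : ℕ} (P : Measure (EuclideanSpace ℝ (Fin d)))
    (μ : Fin k → EuclideanSpace ℝ (Fin d)) : ℝ :=
  ∫ x, ⨅ j, ‖x - μ j‖ ^ 2 ∂P

/-- `μ` is the unique minimizer of the population `k`-means functional. The functional does not
depend on the labels of the centers, so uniqueness is up to a permutation of the centers. -/
structure IsUniqueKMeansSolution {k d : ℕ} (P : Measure (EuclideanSpace ℝ (Fin d)))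
    (μ : Fin k → EuclideanSpace ℝ (Fin d)) : Prop where
  isMin : ∀ ν : Fin k → EuclideanSpace ℝ (Fin d), kMeansRisk P μ ≤ kMeansRisk P ν
  unique : ∀ ν : Fin k → EuclideanSpace ℝ (Fin d), kMeansRisk P ν = kMeansRisk P μ →
    ∃ σ : Equiv.Perm (Fin k), ν = μ ∘ σ

/-! ### Donsker classes -/

/-- The outer expectation of a bounded, not necessarily measurable, real function:
the infimum of the expectations of its measurable integrable majorants. -/
def outerExpectation {Ω : Type*} [MeasurableSpace Ω] (Q : Measure Ω) (T : Ω → ℝ) : ℝ :=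
  sInf {r | ∃ g : Ω → ℝ, Measurable g ∧ Integrable g Q ∧ (∀ ω, T ω ≤ g ω) ∧ r = ∫ ω, g ω ∂Q}

/-- The empirical process `f ↦ √n (n⁻¹ ∑_{i < n} f (X_i) - P f)`, indexed by a class `F` of
functions with values in `ℝ^m`, at the sample sequence `X`. -/
def empiricalProcess {S : Type*} [MeasurableSpace S] {m : ℕ} (P : Measure S)
    (F : Set (S → EuclideanSpace ℝ (Fin m))) (n : ℕ) (X : ℕ → S) :
    F → EuclideanSpace ℝ (Fin m) :=
  fun f => √(n : ℝ) • ((n : ℝ)⁻¹ • ∑ i ∈ Finset.range n, f.1 (X i) - ∫ x, f.1 x ∂P)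

/-- The space `ℓ^∞(F)` of bounded functions `F → ℝ^m`, with the supremum norm. -/
abbrev BoundedFunctions {S : Type*} {m : ℕ} (F : Set (S → EuclideanSpace ℝ (Fin m))) : Type _ :=
  lp (fun _ : F => EuclideanSpace ℝ (Fin m)) ∞

instance {S : Type*} {m : ℕ} (F : Set (S → EuclideanSpace ℝ (Fin m))) :
    MeasurableSpace (BoundedFunctions F) :=
  borel _

instance {S : Type*} {m : ℕ} (F : Set (S → EuclideanSpace ℝ (Fin m))) :
    BorelSpace (BoundedFunctions F) :=
  ⟨rfl⟩

/-- `F` is a `P`-Donsker class of functions with values in `ℝ^m`: its members are measurable and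
square integrable, the sample paths of the empirical process are bounded, and, for an i.i.d. sample
from `P` (the coordinates of the infinite product space), the empirical process converges in
distribution in `ℓ^∞(F)`, in the sense of outer expectations of bounded continuous functions,
to a tight Borel probability law. -/
def IsDonsker {S : Type*} [MeasurableSpace S] {m : ℕ} (P : Measure S) [IsProbabilityMeasure P]
    (F : Set (S → EuclideanSpace ℝ (Fin m))) : Prop :=
  (∀ f ∈ F, Measurable f ∧ MemLp f 2 P) ∧
  ∃ hb : ∀ (n : ℕ) (X : ℕ → S), Memℓp (empiricalProcess P F n X) ∞,
  ∃ L : Measure (BoundedFunctions F), IsProbabilityMeasure L ∧ IsTightMeasureSet {L} ∧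
    ∀ φ : BoundedFunctions F →ᵇ ℝ,
      Tendsto (fun n : ℕ => outerExpectation (Measure.infinitePi fun _ : ℕ => P)
          fun X => φ ⟨empiricalProcess P F n X, hb n X⟩)
        atTop (𝓝 (∫ z, φ z ∂L))

/-! ### Covering numbers -/

/-- The `L²(P)` covering number of a class `F` of square integrable functions with values in `ℝ^m`:
the smallest number of closed `L²(P)`-balls of radius `ε`, with centers in `F`, that cover `F`. -/
def l2CoveringNumber {S : Type*} [MeasurableSpace S] {m : ℕ} (P : Measure S)
    (F : Set (S → EuclideanSpace ℝ (Fin m))) (ε : ℝ≥0) : ℕ∞ :=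
  Metric.coveringNumber ε {g : Lp (EuclideanSpace ℝ (Fin m)) 2 P | ∃ f ∈ F, g =ᵐ[P] f}

end

/-! ### Outer expectations and weak convergence -/

/-! The geometric input is that optimal centers are distinct. If two coincided, one could be moved
anywhere without raising the risk, against uniqueness up to labels
(`IsUniqueKMeansSolution.injective`). Hence on a small enough `K` all centers stay uniformly
separated. If `μ` is within `η` of `ν`, then `h_μ` and `h_ν` differ only where two distances to
centers of `ν` differ by at most `2η`. On a bounded set this region lies in finitely many slabs of
width `O(η)`, so a bounded density gives it mass at most `C η` (`exists_measure_nearTies_le`).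

An `η`-net of `K` has `O(η^(-kd))` elements. The squared `L²` distance of two indicators is at most
the mass above up to a constant, so the choice `η ≈ ε²` gives (ii) with exponent `2kd`.

For (i), nets at scales `2^(-q)` have log-cardinality linear in `q`, while the links between
consecutive nets are bounded with second moment `O(2^(-q))`. Exponential moments at rate of order
`2^(q/2)` bound the mean of the maximal link by `O(q 2^(-q/2))`, which is summable. For the
empirical process these moments come from a Bernstein bound, valid while `2^q ≤ n`; the chain stops
near `2^q = n`, where the brackets absorb the rest. The same bounds for an isonormal process on
`L²(P)` make its step approximations Cauchy in `L¹` with values in `ℓ^∞`, which yields a limit with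
tight law. The central limit theorem handles each fixed `q`, and
`tendsto_outerExpectation_of_approx` lets `q → ∞`. Measurability of the empirical process is never
needed, since its distance to a measurable step process has a measurable majorant with small mean.
-/

lemma exists_lipschitz_majorants {E : Type*} [PseudoMetricSpace E] (φ : E →ᵇ ℝ) :
    ∃ ψ : ℕ → E →ᵇ ℝ, (∀ j : ℕ, LipschitzWith j (ψ j)) ∧ (∀ j z, φ z ≤ ψ j z) ∧
      (∀ j z, |ψ j z| ≤ ‖φ‖) ∧ ∀ z, Tendsto (fun j => ψ j z) atTop (𝓝 (φ z)) := by
  have habs : ∀ z, |φ z| ≤ ‖φ‖ := fun z => φ.norm_coe_le_norm z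
  -- The majorants are the sup-convolutions of `φ` with the cones `-j * dist z w`.
  have hbdd : ∀ (j : ℕ) z, BddAbove (Set.range fun w => φ w - j * dist z w) := by
    rintro j z
    refine ⟨‖φ‖, ?_⟩
    rintro _ ⟨w, rfl⟩
    have := (abs_le.1 (habs w)).2
    have : 0 ≤ (j : ℝ) * dist z w := by positivity
    dsimp only
    linarith
  have hge : ∀ (j : ℕ) z, φ z ≤ ⨆ w, φ w - j * dist z w := by
    intro j z
    simpa using le_ciSup (hbdd j z) z
  have hle : ∀ (j : ℕ) z, (⨆ w, φ w - j * dist z w) ≤ ‖φ‖ := by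
    intro j z
    have : Nonempty E := ⟨z⟩
    refine ciSup_le fun w => ?_
    have := (abs_le.1 (habs w)).2
    have : 0 ≤ (j : ℝ) * dist z w := by positivity
    linarith
  have hlip : ∀ j : ℕ, LipschitzWith j (fun z => ⨆ w, φ w - j * dist z w) := by
    intro j
    refine LipschitzWith.of_le_add_mul _ fun z z' => ?_
    have : Nonempty E := ⟨z⟩
    refine ciSup_le fun w => ?_
    have h1 := le_ciSup (hbdd j z') w
    have h2 := dist_triangle z' z w
    rw [dist_comm z' z] at h2
    have h3 : (j : ℝ) * dist z' w ≤ j * (dist z z' + dist z w) :=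
      mul_le_mul_of_nonneg_left h2 (by positivity)
    simp only [NNReal.coe_natCast] at h1 ⊢
    linarith
  refine ⟨fun j => BoundedContinuousFunction.ofNormedAddCommGroup
    (fun z => ⨆ w, φ w - j * dist z w) (hlip j).continuous ‖φ‖ fun z => ?_, hlip, hge, ?_, ?_⟩
  · rw [Real.norm_eq_abs, abs_le]
    exact ⟨(abs_le.1 (habs z)).1.trans (hge j z), hle j z⟩
  · intro j z
    exact abs_le.2 ⟨(abs_le.1 (habs z)).1.trans (hge j z), hle j z⟩
  · intro z
    rw [Metric.tendsto_atTop]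
    intro ε hε
    obtain ⟨δ, hδ, h⟩ := Metric.continuous_iff.1 φ.continuous z (ε / 2) (half_pos hε)
    -- Beyond this slope, points at distance at least `δ` pay a penalty larger than the oscillation
    -- of `φ`, so only the `δ`-ball matters for the supremum.
    obtain ⟨J, hJ⟩ := exists_nat_gt (2 * ‖φ‖ / δ)
    refine ⟨J, fun j hj => ?_⟩
    have hup : (⨆ w, φ w - j * dist z w) ≤ φ z + ε / 2 := by
      have : Nonempty E := ⟨z⟩
      refine ciSup_le fun w => ?_
      have h0 : 0 ≤ (j : ℝ) * dist z w := by positivity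
      by_cases hw : dist w z < δ
      · have := (abs_lt.1 (Real.dist_eq (φ w) (φ z) ▸ h w hw)).2
        linarith
      · rw [not_lt, dist_comm] at hw
        have h1 : 2 * ‖φ‖ < J * δ := (div_lt_iff₀ hδ).1 hJ
        have h2 : (J : ℝ) * δ ≤ j * dist z w := by
          have : (J : ℝ) ≤ j := by exact_mod_cast hj
          gcongr
        have := (abs_le.1 (habs w)).2
        have := (abs_le.1 (habs z)).1
        linarith
    change dist (⨆ w, φ w - j * dist z w) (φ z) < ε
    rw [Real.dist_eq, abs_lt]
    have := hge j z
    constructor <;> linarith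

/-- The lower bound `-C` makes the set of majorant means bounded below, so that `sInf` is a true
infimum. -/
lemma outerExpectation_le {Ω : Type*} [MeasurableSpace Ω] {Q : Measure Ω} [IsProbabilityMeasure Q]
    {T g : Ω → ℝ} {C : ℝ} (hT : ∀ ω, -C ≤ T ω) (hg : Measurable g) (hgi : Integrable g Q)
    (h : ∀ ω, T ω ≤ g ω) : outerExpectation Q T ≤ ∫ ω, g ω ∂Q := by
  refine csInf_le ⟨-C, ?_⟩ ⟨g, hg, hgi, h, rfl⟩
  rintro _ ⟨f, -, hfi, hf, rfl⟩
  have := integral_mono (integrable_const (μ := Q) (-C)) hfi fun ω => (hT ω).trans (hf ω)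
  simpa using this

/-- The upper bound `C` supplies a constant majorant, so that `sInf` is not taken over the empty
set. -/
lemma le_outerExpectation {Ω : Type*} [MeasurableSpace Ω] {Q : Measure Ω} [IsProbabilityMeasure Q]
    {T g : Ω → ℝ} {C : ℝ} (hT : ∀ ω, T ω ≤ C) (hgi : Integrable g Q)
    (h : ∀ ω, g ω ≤ T ω) : ∫ ω, g ω ∂Q ≤ outerExpectation Q T := by
  refine le_csInf ⟨_, fun _ => C, measurable_const, integrable_const C, hT, rfl⟩ ?_
  rintro _ ⟨f, -, hfi, hf, rfl⟩
  exact integral_mono hgi hfi fun ω => (h ω).trans (hf ω)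

/-- A weak convergence criterion for non-measurable maps `G n`: they are uniformly close, in mean,
to measurable maps `Y q n` which converge in distribution as `n → ∞`, to laws that converge
to `L` as `q → ∞`. -/
theorem tendsto_outerExpectation_of_approx {Ω E : Type*} [MeasurableSpace Ω] {Q : Measure Ω}
    [IsProbabilityMeasure Q] [PseudoMetricSpace E] [MeasurableSpace E] [BorelSpace E]
    (G : ℕ → Ω → E) (Y : ℕ → ℕ → Ω → E) (Lq : ℕ → Measure E) (L : Measure E)
    [IsProbabilityMeasure L] (hY : ∀ q n, Measurable (Y q n))
    (hYL : ∀ q (φ : E →ᵇ ℝ), Tendsto (fun n => ∫ ω, φ (Y q n ω) ∂Q) atTop (𝓝 (∫ z, φ z ∂Lq q)))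
    (hL : ∀ (φ : E →ᵇ ℝ) (K : ℝ≥0), LipschitzWith K φ →
      Tendsto (fun q => ∫ z, φ z ∂Lq q) atTop (𝓝 (∫ z, φ z ∂L)))
    (hG : ∀ ε : ℝ, 0 < ε → ∀ᶠ q in atTop, ∀ᶠ n in atTop, ∃ D : Ω → ℝ, Measurable D ∧
      Integrable D Q ∧ (∀ ω, dist (G n ω) (Y q n ω) ≤ D ω) ∧ ∫ ω, D ω ∂Q ≤ ε)
    (φ : E →ᵇ ℝ) :
    Tendsto (fun n => outerExpectation Q fun ω => φ (G n ω)) atTop (𝓝 (∫ z, φ z ∂L)) := by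
  -- Only upper bounds are needed; the lower one is the case of `-φ`. The error `ε` is split in
  -- four: from `φ` to a Lipschitz majorant, from `L` to `Lq q`, from `Lq q` to `Y q n`, and the
  -- Lipschitz constant times the mean of `D`.
  have key : ∀ (φ : E →ᵇ ℝ) (ε : ℝ), 0 < ε → ∀ᶠ n in atTop, ∃ g : Ω → ℝ, Measurable g ∧
      Integrable g Q ∧ (∀ ω, φ (G n ω) ≤ g ω) ∧ ∫ ω, g ω ∂Q ≤ ∫ z, φ z ∂L + ε := by
    intro φ ε hε
    obtain ⟨ψ, hlip, hge, hbd, hlim⟩ := exists_lipschitz_majorants φ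
    have hint : Tendsto (fun j => ∫ z, ψ j z ∂L) atTop (𝓝 (∫ z, φ z ∂L)) := by
      refine tendsto_integral_of_dominated_convergence (fun _ => ‖φ‖)
        (fun j => (ψ j).continuous.measurable.aestronglyMeasurable) (integrable_const _)
        (fun j => ae_of_all _ fun z => hbd j z) (ae_of_all _ hlim)
    obtain ⟨j, hj⟩ := (hint.eventually_lt_const (show _ < ∫ z, φ z ∂L + ε / 4 by linarith)).exists
    have hε' : 0 < ε / (4 * (j + 1)) := by positivity
    obtain ⟨q, hq, hqG⟩ := (((hL (ψ j) j (hlip j)).eventually_lt_const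
      (show _ < ∫ z, ψ j z ∂L + ε / 4 by linarith)).and (hG _ hε')).exists
    filter_upwards [hqG, (hYL q (ψ j)).eventually_lt_const
      (show _ < ∫ z, ψ j z ∂Lq q + ε / 4 by linarith)] with n ⟨D, hDm, hDi, hD, hDε⟩ hn
    have hψm : Measurable fun ω => ψ j (Y q n ω) := (ψ j).continuous.measurable.comp (hY q n)
    have hψi : Integrable (fun ω => ψ j (Y q n ω)) Q :=
      Integrable.of_bound hψm.aestronglyMeasurable ‖φ‖ (ae_of_all _ fun ω => hbd j _)
    refine ⟨fun ω => ψ j (Y q n ω) + j * D ω, hψm.add (hDm.const_mul _),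
      hψi.add (hDi.const_mul _), fun ω => ?_, ?_⟩
    · have h1 := hge j (G n ω)
      have h2 := (hlip j).dist_le_mul (G n ω) (Y q n ω)
      rw [Real.dist_eq, NNReal.coe_natCast] at h2
      have h3 : (j : ℝ) * dist (G n ω) (Y q n ω) ≤ j * D ω :=
        mul_le_mul_of_nonneg_left (hD ω) (by positivity)
      have h4 := le_abs_self (ψ j (G n ω) - ψ j (Y q n ω))
      dsimp only
      linarith
    · rw [integral_add hψi (hDi.const_mul _), integral_const_mul]
      have h4 : (j : ℝ) * ∫ ω, D ω ∂Q ≤ ε / 4 := by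
        calc (j : ℝ) * ∫ ω, D ω ∂Q ≤ j * (ε / (4 * (j + 1))) := by gcongr
          _ = ε / 4 * (j / (j + 1)) := by field_simp
          _ ≤ ε / 4 * 1 := by
            gcongr
            rw [div_le_one (by positivity)]
            linarith
          _ = ε / 4 := mul_one _
      linarith
  have hφ : ∀ z, -‖φ‖ ≤ φ z ∧ φ z ≤ ‖φ‖ := fun z => abs_le.1 (φ.norm_coe_le_norm z)
  rw [Metric.tendsto_atTop']
  intro ε hε
  obtain ⟨N, hN⟩ := eventually_atTop.1 ((key φ (ε / 2) (by linarith)).and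
    (key (-φ) (ε / 2) (by linarith)))
  refine ⟨N, fun n hn => ?_⟩
  obtain ⟨⟨g, hgm, hgi, hg, hgε⟩, f, hfm, hfi, hf, hfε⟩ := hN n hn.le
  have h1 := outerExpectation_le (fun ω => (hφ (G n ω)).1) hgm hgi hg
  have h2 := le_outerExpectation (Q := Q) (T := fun ω => φ (G n ω)) (g := fun ω => -f ω)
    (fun ω => (hφ (G n ω)).2) hfi.neg (fun ω => by have := hf ω; simp at this; linarith)
  rw [integral_neg] at h2
  simp only [BoundedContinuousFunction.coe_neg, Pi.neg_apply, integral_neg] at hfε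
  rw [Real.dist_eq, abs_lt]
  constructor <;> linarith

/-! ### Exponential moments -/

/-- From `r |x| - c + 1 ≤ exp (r |x| - c)`, with the exponential bounded by the sum over all indices
and both signs, one obtains an explicit measurable majorant. The factor `exp (-c)` cancels the
cardinality when it is integrated. -/
lemma exists_integrable_bound_of_exp_moment {Ω ι : Type*} [MeasurableSpace Ω] {Q : Measure Ω}
    [IsProbabilityMeasure Q] [Fintype ι] (x : ι → Ω → ℝ) {r c M : ℝ} (hr : 0 < r) (hc : 0 ≤ c)
    (hM : 0 ≤ M)
    (hx : ∀ i, Measurable (x i))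
    (hpos : ∀ i, Integrable (fun ω => Real.exp (r * x i ω)) Q)
    (hneg : ∀ i, Integrable (fun ω => Real.exp (-r * x i ω)) Q)
    (hpos' : ∀ i, ∫ ω, Real.exp (r * x i ω) ∂Q ≤ M)
    (hneg' : ∀ i, ∫ ω, Real.exp (-r * x i ω) ∂Q ≤ M)
    (hcard : (Fintype.card ι : ℝ) ≤ Real.exp c) :
    ∃ Z : Ω → ℝ, Measurable Z ∧ Integrable Z Q ∧ (∀ ω, 0 ≤ Z ω) ∧ (∀ i ω, |x i ω| ≤ Z ω) ∧
      ∫ ω, Z ω ∂Q ≤ r⁻¹ * (c + 2 * M) := by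
  have hi : ∀ i, Integrable (fun ω => Real.exp (r * x i ω) + Real.exp (-r * x i ω)) Q :=
    fun i => (hpos i).add (hneg i)
  have hs : Integrable (fun ω => Real.exp (-c) *
      ∑ i, (Real.exp (r * x i ω) + Real.exp (-r * x i ω))) Q :=
    (integrable_finsetSum _ fun i _ => hi i).const_mul _
  refine ⟨fun ω => r⁻¹ * (c + Real.exp (-c) *
    ∑ i, (Real.exp (r * x i ω) + Real.exp (-r * x i ω))), ?_, ?_, ?_, ?_, ?_⟩
  · fun_prop
  · exact ((integrable_const c).add hs).const_mul _
  · intro ω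
    positivity
  · intro i ω
    have h1 : Real.exp (r * |x i ω|) ≤ ∑ i, (Real.exp (r * x i ω) + Real.exp (-r * x i ω)) := by
      refine le_trans ?_ (Finset.single_le_sum
        (f := fun i => Real.exp (r * x i ω) + Real.exp (-r * x i ω))
        (fun i _ => by positivity) (Finset.mem_univ i))
      rcases abs_cases (x i ω) with ⟨h, -⟩ | ⟨h, -⟩ <;> rw [h]
      · linarith [Real.exp_pos (-r * x i ω)]
      · rw [mul_neg, ← neg_mul]
        linarith [Real.exp_pos (r * x i ω)]
    have h2 := Real.add_one_le_exp (r * |x i ω| - c)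
    rw [sub_eq_neg_add, Real.exp_add] at h2
    have h3 := mul_le_mul_of_nonneg_left h1 (Real.exp_pos (-c)).le
    dsimp only
    rw [← div_eq_inv_mul, le_div_iff₀ hr, mul_comm]
    linarith
  · rw [integral_const_mul, integral_add (integrable_const _) hs, integral_const_mul,
      integral_finsetSum _ fun i _ => hi i]
    simp only [integral_const, probReal_univ, one_smul]
    refine mul_le_mul_of_nonneg_left (add_le_add le_rfl ?_) (inv_nonneg.2 hr.le)
    calc Real.exp (-c) * ∑ i, ∫ ω, (Real.exp (r * x i ω) + Real.exp (-r * x i ω)) ∂Q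
        ≤ Real.exp (-c) * ∑ i : ι, (2 * M) := by
          gcongr with i
          rw [integral_add (hpos i) (hneg i)]
          linarith [hpos' i, hneg' i]
      _ = Real.exp (-c) * Fintype.card ι * (2 * M) := by
          rw [Finset.sum_const, Finset.card_univ, nsmul_eq_mul]; ring
      _ ≤ Real.exp (-c) * Real.exp c * (2 * M) := by gcongr
      _ = 2 * M := by rw [← Real.exp_add]; simp

/-! ### The scalar empirical process -/

/-- The empirical process `√n (n⁻¹ ∑_{i < n} g (X_i) - P g)` of a real function `g`. -/
noncomputable def scalarEmpirical {S : Type*} [MeasurableSpace S] (P : Measure S) (n : ℕ)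
    (g : S → ℝ) (X : ℕ → S) : ℝ :=
  √(n : ℝ) * ((n : ℝ)⁻¹ * ∑ i ∈ Finset.range n, g (X i) - ∫ x, g x ∂P)

section
variable {S : Type*} [MeasurableSpace S] {P : Measure S}

lemma measurable_scalarEmpirical {n : ℕ} {g : S → ℝ} (hg : Measurable g) :
    Measurable (scalarEmpirical P n g) := by
  unfold scalarEmpirical
  fun_prop

lemma scalarEmpirical_eq (n : ℕ) (g : S → ℝ) (X : ℕ → S) :
    scalarEmpirical P n g X = (√(n : ℝ))⁻¹ * ∑ i ∈ Finset.range n, (g (X i) - ∫ x, g x ∂P) := by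
  rcases Nat.eq_zero_or_pos n with rfl | hn
  · simp [scalarEmpirical]
  · have h : (0 : ℝ) < n := by exact_mod_cast hn
    have h2 : √(n : ℝ) * √(n : ℝ) = n := Real.mul_self_sqrt h.le
    have h3 : 0 < √(n : ℝ) := Real.sqrt_pos.2 h
    rw [scalarEmpirical, Finset.sum_sub_distrib, Finset.sum_const, Finset.card_range, nsmul_eq_mul]
    field_simp
    rw [sq, h2]

lemma scalarEmpirical_sub {n : ℕ} {f g : S → ℝ} (hf : Integrable f P) (hg : Integrable g P)
    (X : ℕ → S) :
    scalarEmpirical P n (fun x => f x - g x) X =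
      scalarEmpirical P n f X - scalarEmpirical P n g X := by
  rw [scalarEmpirical, scalarEmpirical, scalarEmpirical, integral_sub hf hg,
    Finset.sum_sub_distrib]
  ring

lemma scalarEmpirical_sum {ι : Type*} {n : ℕ} (s : Finset ι) (t : ι → ℝ) {f : ι → S → ℝ}
    (hf : ∀ i ∈ s, Integrable (f i) P) (X : ℕ → S) :
    scalarEmpirical P n (fun x => ∑ i ∈ s, t i * f i x) X =
      ∑ i ∈ s, t i * scalarEmpirical P n (f i) X := by
  simp only [scalarEmpirical]
  rw [integral_finsetSum _ fun i hi => (hf i hi).const_mul _, Finset.sum_comm, Finset.mul_sum,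
    ← Finset.sum_sub_distrib, Finset.mul_sum]
  refine Finset.sum_congr rfl fun i _ => ?_
  rw [integral_const_mul, ← Finset.mul_sum]
  ring

/-- Writing `Pₙ` for the empirical mean, `|Pₙ g - P g| ≤ Pₙ b + P b = (Pₙ b - P b) + 2 P b`. This
trades a function that ranges over an infinite class for its bracket, at the price of a bias of
order `√n P b`. -/
lemma abs_scalarEmpirical_le_of_abs_le {n : ℕ} {g b : S → ℝ} (hb : Integrable b P)
    (h : ∀ x, |g x| ≤ b x) (X : ℕ → S) :
    |scalarEmpirical P n g X| ≤ scalarEmpirical P n b X + 2 * √(n : ℝ) * ∫ x, b x ∂P := by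
  have h1 : |∫ x, g x ∂P| ≤ ∫ x, b x ∂P := by
    rw [← Real.norm_eq_abs]
    exact norm_integral_le_of_norm_le hb (ae_of_all _ h)
  have h2 : |∑ i ∈ Finset.range n, g (X i)| ≤ ∑ i ∈ Finset.range n, b (X i) :=
    (Finset.abs_sum_le_sum_abs _ _).trans (Finset.sum_le_sum fun i _ => h _)
  have h3 : |(n : ℝ)⁻¹ * ∑ i ∈ Finset.range n, g (X i)| ≤
      (n : ℝ)⁻¹ * ∑ i ∈ Finset.range n, b (X i) := by
    rw [abs_mul, abs_of_nonneg (by positivity : (0 : ℝ) ≤ (n : ℝ)⁻¹)]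
    gcongr
  have h4 := abs_sub ((n : ℝ)⁻¹ * ∑ i ∈ Finset.range n, g (X i)) (∫ x, g x ∂P)
  rw [scalarEmpirical, scalarEmpirical, abs_mul, abs_of_nonneg (Real.sqrt_nonneg _)]
  calc _ ≤ √(n : ℝ) * ((n : ℝ)⁻¹ * ∑ i ∈ Finset.range n, b (X i) + ∫ x, b x ∂P) := by
        gcongr; linarith
    _ = _ := by ring

variable [IsProbabilityMeasure P]

lemma iIndepFun_sample {g : S → ℝ} (hg : Measurable g) :
    ProbabilityTheory.iIndepFun (fun (i : ℕ) (X : ℕ → S) => g (X i))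
      (Measure.infinitePi fun _ : ℕ => P) :=
  ProbabilityTheory.iIndepFun_infinitePi (X := fun _ => g) fun _ => hg

lemma map_sample {g : S → ℝ} (hg : Measurable g) (i : ℕ) :
    (Measure.infinitePi fun _ : ℕ => P).map (fun X => g (X i)) = P.map g := by
  conv_rhs => rw [← Measure.infinitePi_map_eval (fun _ : ℕ => P) i]
  rw [Measure.map_map hg (by fun_prop)]
  rfl

lemma identDistrib_sample {g : S → ℝ} (hg : Measurable g) (i : ℕ) :
    ProbabilityTheory.IdentDistrib (fun X : ℕ → S => g (X i)) g
      (Measure.infinitePi fun _ : ℕ => P) P :=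
  ⟨(hg.comp (measurable_pi_apply i)).aemeasurable, hg.aemeasurable, map_sample hg i⟩

/-- A Bernstein bound for the moment generating function of the empirical process. -/
lemma integral_exp_scalarEmpirical_le {n : ℕ} {g : S → ℝ} {B r : ℝ} (hg : Measurable g)
    (hB : ∀ x, |g x| ≤ B) (hn : 0 < n) (hr : |r| * (2 * B) ≤ √(n : ℝ)) :
    Integrable (fun X => Real.exp (r * scalarEmpirical P n g X))
        (Measure.infinitePi fun _ : ℕ => P) ∧
      ∫ X, Real.exp (r * scalarEmpirical P n g X) ∂(Measure.infinitePi fun _ : ℕ => P) ≤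
        Real.exp (r ^ 2 * ∫ x, g x ^ 2 ∂P) := by
  have hn' : (0 : ℝ) < n := by exact_mod_cast hn
  have hs : 0 < √(n : ℝ) := Real.sqrt_pos.2 hn'
  have hgi : Integrable g P := Integrable.of_bound hg.aestronglyMeasurable B (ae_of_all _ hB)
  have hg2i : Integrable (fun x => g x ^ 2) P :=
    Integrable.of_bound (hg.pow_const 2).aestronglyMeasurable (B ^ 2) (ae_of_all _ fun x => by
      rw [Real.norm_eq_abs, abs_pow]
      exact pow_le_pow_left₀ (abs_nonneg _) (hB x) 2)
  set e := ∫ x, g x ∂P with he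
  have heB : |e| ≤ B := by
    have := norm_integral_le_of_norm_le_const (μ := P) (f := g) (ae_of_all _ hB)
    simpa using this
  set h : S → ℝ := fun x => g x - e with hh
  have hhm : Measurable h := hg.sub_const _
  have hhB : ∀ x, |h x| ≤ 2 * B := fun x => by
    have := abs_sub (g x) e
    have := hB x
    simp only [hh]
    linarith
  -- The hypothesis on `r` says exactly that `s` times the bound `2 * B` of the centered function is
  -- at most `1` in absolute value, so that `exp t ≤ 1 + t + t²` applies.
  set s := r * (√(n : ℝ))⁻¹ with hsdef
  have hsh : ∀ x, |s * h x| ≤ 1 := fun x => by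
    rw [abs_mul, hsdef, abs_mul, abs_of_pos (inv_pos.2 hs), mul_comm |r|, mul_assoc,
      ← div_eq_inv_mul, div_le_one hs]
    exact (mul_le_mul_of_nonneg_left (hhB x) (abs_nonneg r)).trans hr
  have hfun : (fun X => Real.exp (r * scalarEmpirical P n g X)) =
      fun X => Real.exp (s * (∑ i ∈ Finset.range n, fun X : ℕ → S => h (X i)) X) := by
    funext X
    rw [scalarEmpirical_eq, Finset.sum_apply, ← mul_assoc]
  have hb : ∀ X : ℕ → S, |∑ i ∈ Finset.range n, s * h (X i)| ≤ n := fun X => by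
    refine (Finset.abs_sum_le_sum_abs _ _).trans ?_
    refine (Finset.sum_le_sum fun i _ => hsh (X i)).trans ?_
    simp
  refine ⟨?_, ?_⟩
  · refine Integrable.of_bound ((measurable_scalarEmpirical hg).const_mul r).exp.aestronglyMeasurable
      (Real.exp n) (ae_of_all _ fun X => ?_)
    rw [congr_fun hfun X, Real.norm_eq_abs, Real.abs_exp, Finset.sum_apply, Finset.mul_sum]
    exact Real.exp_le_exp.2 (abs_le.1 (hb X)).2
  · have h1 : ∫ x, h x ∂P = 0 := by
      rw [hh, integral_sub hgi (integrable_const _)]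
      simp [he]
    have hh2i : Integrable (fun x => h x ^ 2) P :=
      Integrable.of_bound (hhm.pow_const 2).aestronglyMeasurable ((2 * B) ^ 2)
        (ae_of_all _ fun x => by
          rw [Real.norm_eq_abs, abs_pow]
          exact pow_le_pow_left₀ (abs_nonneg _) (hhB x) 2)
    have hhi : Integrable h P := hgi.sub (integrable_const _)
    have h2 : ∫ x, h x ^ 2 ∂P ≤ ∫ x, g x ^ 2 ∂P := by
      have : ∀ x, h x ^ 2 = g x ^ 2 - (2 * e * g x - e ^ 2) := fun x => by simp only [hh]; ring
      simp_rw [this]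
      have hi : Integrable (fun x => 2 * e * g x - e ^ 2) P :=
        (hgi.const_mul _).sub (integrable_const _)
      rw [integral_sub hg2i hi,
        integral_sub (hgi.const_mul _) (integrable_const _), integral_const_mul, ← he]
      simp only [integral_const, probReal_univ, one_smul]
      nlinarith [sq_nonneg e]
    have hi : Integrable (fun x => 1 + s * h x) P := (integrable_const _).add (hhi.const_mul _)
    have h3 : ProbabilityTheory.mgf h P s ≤ Real.exp (s ^ 2 * ∫ x, g x ^ 2 ∂P) := by
      calc ProbabilityTheory.mgf h P s ≤ ∫ x, (1 + s * h x + s ^ 2 * h x ^ 2) ∂P := by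
            refine integral_mono_of_nonneg (ae_of_all _ fun x => (Real.exp_pos _).le)
              (hi.add (hh2i.const_mul _))
              (ae_of_all _ fun x => ?_)
            have := (abs_le.1 (Real.abs_exp_sub_one_sub_id_le (hsh x))).2
            rw [mul_pow] at this
            dsimp only
            linarith
        _ = 1 + s ^ 2 * ∫ x, h x ^ 2 ∂P := by
            rw [integral_add hi (hh2i.const_mul _),
              integral_add (integrable_const _) (hhi.const_mul _), integral_const_mul,
              integral_const_mul, h1]
            simp
        _ ≤ 1 + s ^ 2 * ∫ x, g x ^ 2 ∂P := by gcongr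
        _ ≤ _ := by rw [add_comm]; exact Real.add_one_le_exp _
    rw [hfun]
    change ProbabilityTheory.mgf (∑ i ∈ Finset.range n, fun X : ℕ → S => h (X i))
      (Measure.infinitePi fun _ : ℕ => P) s ≤ _
    rw [(iIndepFun_sample hhm).mgf_sum (fun i => by fun_prop)]
    have h4 : ∀ i ∈ Finset.range n, ProbabilityTheory.mgf (fun X : ℕ → S => h (X i))
        (Measure.infinitePi fun _ : ℕ => P) s = ProbabilityTheory.mgf h P s := fun i _ =>
      congr_fun (ProbabilityTheory.mgf_congr_identDistrib (identDistrib_sample hhm i)) s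
    rw [Finset.prod_congr rfl h4, Finset.prod_const, Finset.card_range]
    calc ProbabilityTheory.mgf h P s ^ n ≤ Real.exp (s ^ 2 * ∫ x, g x ^ 2 ∂P) ^ n :=
          pow_le_pow_left₀ ProbabilityTheory.mgf_nonneg h3 n
      _ = _ := by
          rw [← Real.exp_nat_mul, hsdef, mul_pow, inv_pow, Real.sq_sqrt hn'.le]
          congr 1
          field_simp

end

/-! ### An isonormal Gaussian process -/

open ProbabilityTheory in
/-- On a suitable probability space, a Hilbert space embeds isometrically into `L²` as a space of
centered Gaussian variables. -/
theorem exists_isonormal.{u} {H : Type u} [NormedAddCommGroup H] [InnerProductSpace ℝ H]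
    [CompleteSpace H] :
    ∃ (Ω : Type u) (_ : MeasurableSpace Ω) (Q : Measure Ω) (_ : IsProbabilityMeasure Q)
      (W : H →ₗᵢ[ℝ] Lp ℝ 2 Q), ∀ h, Q.map (W h) = gaussianReal 0 (‖h‖₊ ^ 2) := by
  obtain ⟨w, b, -⟩ := exists_hilbertBasis ℝ H
  obtain ⟨Ω, mΩ, Q, ξ, hξm, hξl, hind, hQ⟩ := exists_iid w (gaussianReal 0 1)
  have hξ2 : ∀ i, MemLp (ξ i) 2 Q := fun i => by
    have h : MemLp id 2 (Q.map (ξ i)) := by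
      rw [(hξl i).map_eq]
      exact memLp_id_gaussianReal 2
    exact h.comp_of_map (hξm i).aemeasurable
  have hmean : ∀ i, ∫ ω, ξ i ω ∂Q = 0 := fun i => by
    have := (hξl i).integral_eq
    simpa using this
  have hsq : ∀ i, ∫ ω, ξ i ω * ξ i ω ∂Q = 1 := fun i => by
    have h := variance_of_integral_eq_zero (hξm i).aemeasurable (hmean i)
    rw [(hξl i).variance_eq, variance_id_gaussianReal] at h
    simpa [sq] using h.symm
  have hinner : ∀ i j, inner ℝ ((hξ2 i).toLp (ξ i)) ((hξ2 j).toLp (ξ j)) =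
      ∫ ω, ξ i ω * ξ j ω ∂Q := fun i j => by
    rw [L2.inner_def]
    refine integral_congr_ae ?_
    filter_upwards [(hξ2 i).coeFn_toLp, (hξ2 j).coeFn_toLp] with ω h1 h2
    rw [h1, h2]
    simp [mul_comm]
  have hv : Orthonormal ℝ fun i => (hξ2 i).toLp (ξ i) := by
    classical
    rw [orthonormal_iff_ite]
    intro i j
    rw [hinner]
    split_ifs with h
    · rw [← h, hsq]
    · rw [(hind.indepFun h).integral_fun_mul_eq_mul_integral (hξm i).aestronglyMeasurable
        (hξm j).aestronglyMeasurable, hmean, zero_mul]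
  let W : H →ₗᵢ[ℝ] Lp ℝ 2 Q :=
    hv.orthogonalFamily.linearIsometry.comp b.repr.toLinearIsometry
  have hW : ∀ i, W (b i) = (hξ2 i).toLp (ξ i) := fun i => by
    classical
    change hv.orthogonalFamily.linearIsometry (b.repr (b i)) = _
    rw [b.repr_self, OrthogonalFamily.linearIsometry_apply_single]
    simp
  -- Both sides are continuous in `h` and agree on finite combinations of basis vectors, where
  -- independence factorizes the left side. Replacing `h` by `t • h` later gives the whole
  -- characteristic function.
  have hcf : ∀ h, ∫ ω, Complex.exp (W h ω * Complex.I) ∂Q = Real.exp (-‖h‖ ^ 2 / 2) := by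
    intro h
    have hi : ∀ h, Integrable (fun ω => Complex.exp (W h ω * Complex.I)) Q := fun h => by
      refine Integrable.of_bound ?_ 1 (ae_of_all _ fun ω => by simp [Complex.norm_exp_ofReal_mul_I])
      have := (Lp.stronglyMeasurable (W h)).measurable
      fun_prop
    -- Since `|exp (ia) - exp (ib)| ≤ |a - b|`, the difference is at most an `L¹` norm, hence at
    -- most the `L²` norm, which `W` preserves.
    have hdist : ∀ h h', dist (∫ ω, Complex.exp (W h ω * Complex.I) ∂Q)
        (∫ ω, Complex.exp (W h' ω * Complex.I) ∂Q) ≤ dist h h' := by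
      intro h h'
      rw [dist_eq_norm, ← integral_sub (hi h) (hi h')]
      have h1 : ‖∫ ω, (Complex.exp (W h ω * Complex.I) - Complex.exp (W h' ω * Complex.I)) ∂Q‖ ≤
          ∫ ω, ‖W (h - h') ω‖ ∂Q := by
        refine norm_integral_le_of_norm_le ((Lp.memLp (W (h - h'))).integrable (by norm_num)).norm ?_
        rw [map_sub]
        filter_upwards [Lp.coeFn_sub (W h) (W h')] with ω hω
        rw [hω, Pi.sub_apply]
        have h2 : Complex.exp (W h ω * Complex.I) - Complex.exp (W h' ω * Complex.I) =
            Complex.exp (W h' ω * Complex.I) *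
              (Complex.exp (Complex.I * (W h ω - W h' ω : ℝ)) - 1) := by
          rw [mul_sub, ← Complex.exp_add, mul_one]
          congr 2
          push_cast
          ring
        rw [h2, norm_mul, Complex.norm_exp_ofReal_mul_I, one_mul]
        exact Real.norm_exp_I_mul_ofReal_sub_one_le
      refine h1.trans ?_
      rw [dist_eq_norm, ← W.norm_map (h - h'), Lp.norm_def,
        integral_norm_eq_lintegral_enorm (Lp.aestronglyMeasurable _),
        ← eLpNorm_one_eq_lintegral_enorm]
      exact ENNReal.toReal_mono (Lp.eLpNorm_ne_top _)
        (eLpNorm_le_eLpNorm_of_exponent_le (by norm_num) (Lp.aestronglyMeasurable _))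
    have hfin : ∀ (s : Finset w) (a : w → ℝ),
        ∫ ω, Complex.exp (W (∑ i ∈ s, a i • b i) ω * Complex.I) ∂Q =
          Real.exp (-‖∑ i ∈ s, a i • b i‖ ^ 2 / 2) := by
      intro s a
      have h1 : W (∑ i ∈ s, a i • b i) =ᵐ[Q] fun ω => ∑ i ∈ s, a i * ξ i ω := by
        have h0 : W (∑ i ∈ s, a i • b i) = ∑ i ∈ s, a i • (hξ2 i).toLp (ξ i) := by
          simp [map_sum, hW]
        have h0' : ∀ᵐ ω ∂Q, ∀ i ∈ s, (a i • (hξ2 i).toLp (ξ i) : Lp ℝ 2 Q) ω = a i * ξ i ω := by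
          refine (Finset.eventually_all s).2 fun i _ => ?_
          filter_upwards [Lp.coeFn_smul (a i) ((hξ2 i).toLp (ξ i)), (hξ2 i).coeFn_toLp]
            with ω h3 h4
          rw [h3, Pi.smul_apply, h4, smul_eq_mul]
        rw [h0]
        filter_upwards [Lp.coeFn_finsetSum s fun i => a i • (hξ2 i).toLp (ξ i), h0'] with ω h3 h4
        rw [h3, Finset.sum_apply, Finset.sum_congr rfl h4]
      have h2 : ‖∑ i ∈ s, a i • b i‖ ^ 2 = ∑ i ∈ s, a i ^ 2 := by
        rw [← real_inner_self_eq_norm_sq, b.orthonormal.inner_sum]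
        simp [sq]
      have h3 : ∫ ω, Complex.exp (W (∑ i ∈ s, a i • b i) ω * Complex.I) ∂Q =
          charFun (Q.map fun ω => ∑ i ∈ s, a i * ξ i ω) 1 := by
        rw [charFun_apply_real, integral_map (by fun_prop) (by fun_prop)]
        refine integral_congr_ae ?_
        filter_upwards [h1] with ω hω
        rw [hω]
        simp
      have hind' : iIndepFun (fun i ω => a i * ξ i ω) Q :=
        hind.comp (fun i x => a i * x) fun i => by fun_prop
      rw [h3, (hind'.restrict s).charFun_map_fun_finsetSum_eq_prod (fun i _ => by fun_prop)]
      have h5 : ∀ i, charFun (Q.map fun ω => a i * ξ i ω) 1 = Complex.exp (-(a i : ℂ) ^ 2 / 2) :=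
        fun i => by
          rw [charFun_map_mul_comp (hξm i).aemeasurable, (hξl i).map_eq, charFun_gaussianReal]
          congr 1
          simp
          ring
      rw [Finset.prod_apply, Finset.prod_congr rfl fun i _ => h5 i, ← Complex.exp_sum, h2]
      push_cast
      rw [← Finset.sum_div, Finset.sum_neg_distrib]
    have hlim := b.hasSum_repr h
    have hcont : Continuous fun h => ∫ ω, Complex.exp (W h ω * Complex.I) ∂Q :=
      (LipschitzWith.of_dist_le_mul (K := 1) fun h h' => by simpa using hdist h h').continuous
    have hcont' : Continuous fun h : H => (Real.exp (-‖h‖ ^ 2 / 2) : ℂ) := by fun_prop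
    refine tendsto_nhds_unique ((hcont.tendsto h).comp hlim) ?_
    refine ((hcont'.tendsto h).comp hlim).congr fun s => ?_
    exact (hfin s _).symm
  refine ⟨Ω, mΩ, Q, hQ, W, fun h => Measure.ext_of_charFun (funext fun t => ?_)⟩
  rw [charFun_apply_real, integral_map (Lp.aestronglyMeasurable (W h)).aemeasurable (by fun_prop),
    charFun_gaussianReal]
  have := hcf (t • h)
  rw [map_smul, norm_smul, mul_pow] at this
  have h1 : ∫ ω, Complex.exp (t * W h ω * Complex.I) ∂Q =
      ∫ ω, Complex.exp ((t • W h : Lp ℝ 2 Q) ω * Complex.I) ∂Q := by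
    refine integral_congr_ae ?_
    filter_upwards [Lp.coeFn_smul t (W h)] with ω hω
    rw [hω]
    simp
  rw [h1, this]
  push_cast
  congr 1
  simp [← Complex.ofReal_pow]
  ring

/-! ### The finite-dimensional central limit theorem -/

section
variable {S : Type*} [MeasurableSpace S]

open Classical in
/-- The class in `L²(P)` of the centered function `g - P g`, for `g` in `L²(P)`. -/
noncomputable def centered (P : Measure S) [IsProbabilityMeasure P] (g : S → ℝ) : Lp ℝ 2 P :=
  if hg : MemLp g 2 P then (hg.sub (memLp_const (∫ x, g x ∂P))).toLp else 0

variable {P : Measure S} [IsProbabilityMeasure P]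

lemma coeFn_centered {g : S → ℝ} (hg : MemLp g 2 P) :
    centered P g =ᵐ[P] fun x => g x - ∫ y, g y ∂P := by
  rw [centered, dif_pos hg]
  exact MemLp.coeFn_toLp _

lemma norm_sq_centered {g : S → ℝ} (hg : MemLp g 2 P) :
    ‖centered P g‖ ^ 2 = ProbabilityTheory.variance g P := by
  rw [ProbabilityTheory.variance_eq_integral hg.aestronglyMeasurable.aemeasurable,
    ← real_inner_self_eq_norm_sq, L2.inner_def]
  refine integral_congr_ae ?_
  filter_upwards [coeFn_centered hg] with x hx
  rw [hx]
  simp [sq]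

lemma norm_sq_centered_le {g : S → ℝ} (hg : MemLp g 2 P) :
    ‖centered P g‖ ^ 2 ≤ ∫ x, g x ^ 2 ∂P := by
  rw [norm_sq_centered hg]
  exact ProbabilityTheory.variance_le_expectation_sq hg.aestronglyMeasurable

lemma centered_sum {ι : Type*} (s : Finset ι) (t : ι → ℝ) {g : ι → S → ℝ}
    (hg : ∀ i, MemLp (g i) 2 P) :
    centered P (fun x => ∑ i ∈ s, t i * g i x) = ∑ i ∈ s, t i • centered P (g i) := by
  have h1 : MemLp (fun x => ∑ i ∈ s, t i * g i x) 2 P :=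
    memLp_finsetSum s fun i _ => (hg i).const_mul (t i)
  refine Lp.ext ?_
  have h2 : ∀ᵐ x ∂P, ∀ i ∈ s, (t i • centered P (g i) : Lp ℝ 2 P) x =
      t i * (g i x - ∫ y, g i y ∂P) := by
    refine (Finset.eventually_all s).2 fun i _ => ?_
    filter_upwards [Lp.coeFn_smul (t i) (centered P (g i)), coeFn_centered (hg i)] with x h3 h4
    rw [h3, Pi.smul_apply, h4, smul_eq_mul]
  filter_upwards [coeFn_centered h1, Lp.coeFn_finsetSum s fun i => t i • centered P (g i), h2]
    with x h3 h4 h5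
  rw [h3, h4, Finset.sum_apply, Finset.sum_congr rfl h5,
    integral_finsetSum _ fun i _ => ((hg i).integrable (by norm_num)).const_mul _,
    ← Finset.sum_sub_distrib]
  refine Finset.sum_congr rfl fun i _ => ?_
  rw [integral_const_mul, mul_sub]

lemma centered_sub {f g : S → ℝ} (hf : MemLp f 2 P) (hg : MemLp g 2 P) :
    centered P (fun x => f x - g x) = centered P f - centered P g := by
  refine Lp.ext ?_
  filter_upwards [coeFn_centered (hf.sub hg), Lp.coeFn_sub (centered P f) (centered P g),
    coeFn_centered hf, coeFn_centered hg] with x h1 h2 h3 h4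
  rw [h2, Pi.sub_apply, h3, h4]
  refine h1.trans ?_
  simp only [Pi.sub_apply]
  rw [integral_sub (hf.integrable (by norm_num)) (hg.integrable (by norm_num))]
  ring

open ProbabilityTheory in
-- By the Cramér–Wold device, the characteristic function of the vector at `t` is that of the scalar
-- process of `∑ t_i g_i` at `1`, where the one-dimensional central limit theorem applies. Linearity
-- of `W` and of centering identifies the joint limit without computing a covariance matrix.
theorem tendsto_integral_scalarEmpirical_vector {Ω : Type*} [MeasurableSpace Ω] {Q : Measure Ω}
    [IsProbabilityMeasure Q] (W : Lp ℝ 2 P →ₗᵢ[ℝ] Lp ℝ 2 Q)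
    (hW : ∀ h, Q.map (W h) = gaussianReal 0 (‖h‖₊ ^ 2)) {ι : Type*} [Fintype ι]
    (g : ι → S → ℝ) (hg : ∀ i, Measurable (g i)) (hg2 : ∀ i, MemLp (g i) 2 P)
    (φ : EuclideanSpace ℝ ι →ᵇ ℝ) :
    Tendsto (fun n => ∫ X, φ (WithLp.toLp 2 fun i => scalarEmpirical P n (g i) X)
        ∂(Measure.infinitePi fun _ : ℕ => P)) atTop
      (𝓝 (∫ ω, φ (WithLp.toLp 2 fun i => W (centered P (g i)) ω) ∂Q)) := by
  set V : ℕ → (ℕ → S) → EuclideanSpace ℝ ι :=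
    fun n X => WithLp.toLp 2 fun i => scalarEmpirical P n (g i) X with hV
  set U : Ω → EuclideanSpace ℝ ι := fun ω => WithLp.toLp 2 fun i => W (centered P (g i)) ω with hU
  have hVm : ∀ n, Measurable (V n) := fun n =>
    (WithLp.measurable_toLp 2 _).comp
      (measurable_pi_lambda _ fun i => measurable_scalarEmpirical (hg i))
  have hUm : Measurable U :=
    (WithLp.measurable_toLp 2 _).comp
      (measurable_pi_lambda _ fun i => (Lp.stronglyMeasurable _).measurable)
  have hVp : ∀ n, IsProbabilityMeasure ((Measure.infinitePi fun _ : ℕ => P).map (V n)) :=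
    fun n => Measure.isProbabilityMeasure_map (hVm n).aemeasurable
  have hUp : IsProbabilityMeasure (Q.map U) := Measure.isProbabilityMeasure_map hUm.aemeasurable
  have key : Tendsto (β := ProbabilityMeasure (EuclideanSpace ℝ ι))
      (fun n => ⟨(Measure.infinitePi fun _ : ℕ => P).map (V n), hVp n⟩) atTop
      (𝓝 ⟨Q.map U, hUp⟩) := by
    refine ProbabilityMeasure.tendsto_iff_tendsto_charFun.2 fun t => ?_
    set G : S → ℝ := fun x => ∑ i, t i * g i x with hG
    have hGm : Measurable G := by fun_prop
    have hG2 : MemLp G 2 P := memLp_finsetSum _ fun i _ => (hg2 i).const_mul (t i)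
    have hlaw : HasLaw (W (centered P G)) (gaussianReal 0
        (Var[fun X : ℕ → S => G (X 0); Measure.infinitePi fun _ : ℕ => P]).toNNReal) Q := by
      refine ⟨(Lp.aestronglyMeasurable _).aemeasurable, ?_⟩
      rw [hW, (identDistrib_sample hGm 0).variance_eq, ← norm_sq_centered hG2]
      congr 1
      ext
      simp
    have hclt := ProbabilityMeasure.tendsto_iff_tendsto_charFun.1
      (tendstoInDistribution_inv_sqrt_mul_sum_sub
      (X := fun (i : ℕ) (X : ℕ → S) => G (X i)) hlaw
      ((identDistrib_sample hGm 0).memLp_iff.2 hG2) (iIndepFun_sample hGm)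
      fun i => (identDistrib_sample hGm i).trans (identDistrib_sample hGm 0).symm).tendsto
    have h1 := hclt 1
    have h2 : charFun (Q.map U) t = charFun (Q.map (W (centered P G))) 1 := by
      rw [charFun_apply, charFun_apply_real, integral_map hUm.aemeasurable (by fun_prop),
        integral_map (Lp.aestronglyMeasurable _).aemeasurable (by fun_prop)]
      refine integral_congr_ae ?_
      have h3 : ∀ᵐ ω ∂Q, ∀ i ∈ Finset.univ, (t i • W (centered P (g i)) : Lp ℝ 2 Q) ω =
          t i * W (centered P (g i)) ω := by
        refine (Finset.eventually_all _).2 fun i _ => ?_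
        filter_upwards [Lp.coeFn_smul (t i) (W (centered P (g i)))] with x h3
        rw [h3, Pi.smul_apply, smul_eq_mul]
      rw [hG, centered_sum _ _ hg2, map_sum]
      simp only [map_smul]
      filter_upwards [Lp.coeFn_finsetSum Finset.univ fun i => t i • W (centered P (g i)), h3]
        with ω h4 h5
      rw [h4, Finset.sum_apply, Finset.sum_congr rfl h5]
      simp [hU, PiLp.inner_apply]
    have h3 : ∀ n, charFun ((Measure.infinitePi fun _ : ℕ => P).map (V n)) t =
        charFun ((Measure.infinitePi fun _ : ℕ => P).map fun X => (√(n : ℝ))⁻¹ *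
          (∑ k ∈ Finset.range n, G (X k) -
            n * (Measure.infinitePi fun _ : ℕ => P)[fun X : ℕ → S => G (X 0)])) 1 := by
      intro n
      have h4 : ∀ X : ℕ → S, inner ℝ (V n X) t = (√(n : ℝ))⁻¹ *
          (∑ k ∈ Finset.range n, G (X k) -
            n * (Measure.infinitePi fun _ : ℕ => P)[fun X : ℕ → S => G (X 0)]) := fun X => by
        rw [(identDistrib_sample hGm 0).integral_eq]
        have h5 := scalarEmpirical_sum (P := P) (n := n) Finset.univ t (f := g)
          (fun i _ => (hg2 i).integrable (by norm_num)) X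
        rw [scalarEmpirical_eq, Finset.sum_sub_distrib, Finset.sum_const, Finset.card_range,
          nsmul_eq_mul] at h5
        rw [hG, h5]
        simp [hV, PiLp.inner_apply]
      have hsm : Measurable fun X : ℕ → S => (√(n : ℝ))⁻¹ *
          (∑ k ∈ Finset.range n, G (X k) -
            n * (Measure.infinitePi fun _ : ℕ => P)[fun X : ℕ → S => G (X 0)]) :=
        ((Finset.measurable_fun_sum _ fun i _ =>
          hGm.comp (measurable_pi_apply i)).sub_const _).const_mul _
      rw [charFun_apply, charFun_apply_real, integral_map (hVm n).aemeasurable (by fun_prop),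
        integral_map hsm.aemeasurable (by fun_prop)]
      simp [h4]
    simp only [ProbabilityMeasure.coe_mk] at h1 ⊢
    rw [h2]
    simp_rw [h3]
    exact h1
  have h := (ProbabilityMeasure.tendsto_iff_forall_integral_tendsto.1 key) φ
  simp only [ProbabilityMeasure.coe_mk] at h
  rw [integral_map hUm.aemeasurable φ.continuous.measurable.aestronglyMeasurable] at h
  refine h.congr fun n => ?_
  rw [integral_map (hVm n).aemeasurable φ.continuous.measurable.aestronglyMeasurable]

end

/-! ### Tightness of the law of a strongly measurable map -/

/-- The space `E` may be nonseparable, as `ℓ^∞` usually is, but the closure of the range of `f` is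
separable and complete, and there every finite measure is tight. -/
theorem isTightMeasureSet_map_of_stronglyMeasurable {Ω E : Type*} [MeasurableSpace Ω]
    {Q : Measure Ω} [IsFiniteMeasure Q] [MetricSpace E] [CompleteSpace E] [MeasurableSpace E]
    [BorelSpace E] {f : Ω → E} (hf : StronglyMeasurable f) :
    IsTightMeasureSet {Q.map f} := by
  set A := closure (Set.range f) with hA
  have hsep : TopologicalSpace.IsSeparable A := hf.isSeparable_range.closure
  have : SecondCountableTopology A := by
    have := hsep.separableSpace
    exact UniformSpace.secondCountable_of_separable A
  have : CompleteSpace A := isClosed_closure.completeSpace_coe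
  set g : Ω → A := fun ω => ⟨f ω, subset_closure ⟨ω, rfl⟩⟩ with hg
  have hgm : Measurable g := hf.measurable.subtype_mk
  have ht : IsTightMeasureSet {Q.map g} := isTightMeasureSet_singleton
  rw [isTightMeasureSet_iff_exists_isCompact_measure_compl_le] at ht ⊢
  intro ε hε
  obtain ⟨K, hK, h⟩ := ht ε hε
  have hK' : IsCompact (Subtype.val '' K) := hK.image continuous_subtype_val
  refine ⟨Subtype.val '' K, hK', ?_⟩
  rintro _ rfl
  refine le_trans (le_of_eq ?_) (h _ rfl)
  rw [Measure.map_apply hf.measurable hK'.isClosed.measurableSet.compl,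
    Measure.map_apply hgm hK.isClosed.measurableSet.compl]
  congr 1
  ext ω
  have hω : f ω ∈ A := subset_closure ⟨ω, rfl⟩
  simp [hg, hω]

/-! ### A Donsker theorem for classes with exponentially small brackets -/

/-- A system of nets and brackets for a uniformly bounded class `F` of functions: the `q`-th net has
at most `exp (κ (q + 1))` elements, and the functions of `F` differ from their projections to it
by at most a function with integral at most `C 2^{-q}`. -/
structure BracketSystem {S : Type*} [MeasurableSpace S] {m : ℕ} (P : Measure S)
    (F : Set (S → EuclideanSpace ℝ (Fin m))) where
  /-- The cardinality of the nets. -/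
  N : ℕ → ℕ
  /-- The elements of the nets. -/
  center : ∀ q, Fin (N q) → F
  /-- The projections to the nets. -/
  proj : ∀ q, F → Fin (N q)
  /-- The half-widths of the brackets. -/
  width : ∀ q, Fin (N q) → S → ℝ
  /-- The uniform bound. -/
  B : ℝ
  /-- The constant for the integrals of the half-widths. -/
  C : ℝ
  /-- The constant for the cardinality of the nets. -/
  κ : ℝ
  B_nonneg : 0 ≤ B
  C_nonneg : 0 ≤ C
  κ_nonneg : 0 ≤ κ
  N_le : ∀ q, (N q : ℝ) ≤ Real.exp (κ * (q + 1))
  measurable : ∀ f : F, Measurable f.1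
  norm_le : ∀ (f : F) x, ‖f.1 x‖ ≤ B
  measurable_width : ∀ q i, Measurable (width q i)
  width_nonneg : ∀ q i x, 0 ≤ width q i x
  width_le : ∀ q i x, width q i x ≤ B
  integral_width_le : ∀ q i, ∫ x, width q i x ∂P ≤ C * (1 / 2) ^ q
  norm_sub_le : ∀ q (f : F) x, ‖f.1 x - (center q (proj q f)).1 x‖ ≤ width q (proj q f) x

/-- The linear map that sends a vector indexed by a finite partition of `F` (and by the
coordinates of the target space) to the corresponding step function on `F`. -/
noncomputable def stepMap {S ι : Type*} [Fintype ι] {m : ℕ}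
    {F : Set (S → EuclideanSpace ℝ (Fin m))} (π : F → ι) :
    EuclideanSpace ℝ (ι × Fin m) →L[ℝ] BoundedFunctions F :=
  LinearMap.toContinuousLinearMap
    { toFun := fun v => ⟨fun f => WithLp.toLp 2 fun l => v (π f, l), memℓp_infty
        ((Set.finite_range fun i => ‖(WithLp.toLp 2 fun l => v (i, l) :
          EuclideanSpace ℝ (Fin m))‖).subset (by
            rintro _ ⟨f, rfl⟩
            exact ⟨π f, rfl⟩)).bddAbove⟩
      map_add' := fun v w => by
        ext f l
        rfl
      map_smul' := fun r v => by
        ext f l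
        rfl }

lemma EuclideanSpace.norm_le_card_mul {ι : Type*} [Fintype ι] (v : EuclideanSpace ℝ ι) {r : ℝ}
    (h : ∀ l, |v l| ≤ r) : ‖v‖ ≤ Fintype.card ι * r := by
  classical
  have h1 : v = ∑ l, v l • EuclideanSpace.single l (1 : ℝ) := by
    ext j
    simp [Pi.single_apply]
  rw [h1]
  refine (norm_sum_le _ _).trans ?_
  refine (Finset.sum_le_sum (g := fun _ => r) fun l _ => ?_).trans (by simp)
  rw [norm_smul]
  simpa using h l

lemma norm_boundedFunctions_le {S : Type*} {m : ℕ} {F : Set (S → EuclideanSpace ℝ (Fin m))}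
    {z : BoundedFunctions F} {r : ℝ} (hr : 0 ≤ r)
    (h : ∀ f l, |z f l| ≤ r) : ‖z‖ ≤ m * r := by
  refine lp.norm_le_of_forall_le (by positivity) fun f => ?_
  simpa using EuclideanSpace.norm_le_card_mul (z f) (h f)

/-! ### Chaining links: number, size and exponential moments. -/

section
variable {S : Type*} [MeasurableSpace S] {m : ℕ} {F : Set (S → EuclideanSpace ℝ (Fin m))}

namespace BracketSystem
variable {P : Measure S} (b : BracketSystem P F)

/-- The difference of the `l`-th coordinates of two elements of consecutive nets, if there is a
function in the class that projects to both; `0` otherwise. -/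
noncomputable def link (q : ℕ) (i : (Fin (b.N (q + 1)) × Fin (b.N q)) × Fin m) : S → ℝ :=
  open Classical in
  -- Two unrelated net elements need not be close. With the default `0`, every index obeys the
  -- bounds on links while the index set stays a full product.
  if ∃ f, b.proj (q + 1) f = i.1.1 ∧ b.proj q f = i.1.2 then
    fun x => (b.center (q + 1) i.1.1).1 x i.2 - (b.center q i.1.2).1 x i.2 else 0

lemma link_proj (q : ℕ) (f : F) (l : Fin m) :
    b.link q ((b.proj (q + 1) f, b.proj q f), l) =
      fun x => (b.center (q + 1) (b.proj (q + 1) f)).1 x l - (b.center q (b.proj q f)).1 x l := by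
  rw [link, if_pos ⟨f, rfl, rfl⟩]

lemma measurable_coord (b : BracketSystem P F) (f : F) (l : Fin m) :
    Measurable fun x => f.1 x l := by
  have := b.measurable f
  fun_prop

lemma abs_coord_le (f : F) (l : Fin m) (x : S) : |f.1 x l| ≤ b.B :=
  (PiLp.norm_apply_le (f.1 x) l).trans (b.norm_le f x)

lemma measurable_link (q : ℕ) (i) : Measurable (b.link q i) := by
  rw [link]
  split_ifs
  · exact (b.measurable_coord _ _).sub (b.measurable_coord _ _)
  · exact measurable_zero

lemma abs_link_le (q : ℕ) (i) (x : S) :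
    |b.link q i x| ≤ b.width (q + 1) i.1.1 x + b.width q i.1.2 x := by
  rw [link]
  split_ifs with h
  · obtain ⟨f, h1, h2⟩ := h
    have h3 := (PiLp.norm_apply_le (f.1 x - (b.center (q + 1) i.1.1).1 x) i.2).trans
      (h1 ▸ b.norm_sub_le (q + 1) f x)
    have h4 := (PiLp.norm_apply_le (f.1 x - (b.center q i.1.2).1 x) i.2).trans
      (h2 ▸ b.norm_sub_le q f x)
    simp only [PiLp.sub_apply, Real.norm_eq_abs] at h3 h4
    rw [abs_le] at h3 h4 ⊢
    constructor <;> linarith [h3.1, h3.2, h4.1, h4.2]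
  · simpa using add_nonneg (b.width_nonneg _ _ _) (b.width_nonneg _ _ _)

lemma abs_link_le_two_mul (q : ℕ) (i) (x : S) : |b.link q i x| ≤ 2 * b.B := by
  have := b.abs_link_le q i x
  have := b.width_le (q + 1) i.1.1 x
  have := b.width_le q i.1.2 x
  linarith

/-- A constant that governs the scale of the chaining links. -/
noncomputable def scale : ℝ := 4 * b.B + 4 * b.B * b.C + 1

/-- A constant that governs the number of the chaining links. -/
noncomputable def entropyRate : ℝ := 3 * b.κ + m

/-- The bound for the mean of the maximal chaining link at level `q`. -/
noncomputable def linkBound (q : ℕ) : ℝ :=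
  b.scale * (√2)⁻¹ ^ q * (b.entropyRate * (q + 1) + 2 * Real.exp 1)

lemma scale_pos : 0 < b.scale := by
  have hB := b.B_nonneg
  have hC := b.C_nonneg
  unfold scale
  positivity

lemma entropyRate_nonneg : 0 ≤ b.entropyRate := by
  have := b.κ_nonneg
  unfold entropyRate
  positivity

lemma linkBound_nonneg (q : ℕ) : 0 ≤ b.linkBound q := by
  have := b.scale_pos
  have := b.entropyRate_nonneg
  unfold linkBound
  positivity

/-- The entropy grows linearly in `q` against the geometric decay `2^(-q/2)`; this plays the role of
a finite entropy integral. -/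
lemma summable_linkBound : Summable b.linkBound := by
  have h0 : ‖(√2)⁻¹‖ < 1 := by
    rw [Real.norm_eq_abs, abs_of_pos (by positivity)]
    exact inv_lt_one_of_one_lt₀ (by rw [Real.lt_sqrt] <;> norm_num)
  have h1 : Summable fun q : ℕ => (q : ℝ) ^ 1 * (√2)⁻¹ ^ q :=
    summable_pow_mul_geometric_of_norm_lt_one 1 h0
  have h2 : Summable fun q : ℕ => (√2)⁻¹ ^ q := summable_geometric_of_norm_lt_one h0
  refine ((h1.mul_left (b.scale * b.entropyRate)).add
    (h2.mul_left (b.scale * (b.entropyRate + 2 * Real.exp 1)))).congr fun q => ?_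
  unfold linkBound
  ring

lemma card_link_le (q : ℕ) :
    (Fintype.card ((Fin (b.N (q + 1)) × Fin (b.N q)) × Fin m) : ℝ) ≤
      Real.exp (b.entropyRate * (q + 1)) := by
  have h1 := b.N_le (q + 1)
  have h2 := b.N_le q
  have h3 : (m : ℝ) ≤ Real.exp (m * (q + 1)) :=
    calc (m : ℝ) ≤ m + 1 := by linarith
      _ ≤ Real.exp m := Real.add_one_le_exp _
      _ ≤ _ := Real.exp_le_exp.2 <|
          le_mul_of_one_le_right (by positivity) (by linarith [(q.cast_nonneg : (0 : ℝ) ≤ q)])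
  -- As `q + 2 ≤ 2 (q + 1)`, the finer net costs `2κ` and the coarser one `κ`, which explains the
  -- `3κ` in `entropyRate`.
  have h4 : b.κ * ((q + 1 : ℕ) + 1) ≤ 2 * b.κ * (q + 1) := by
    have := b.κ_nonneg
    push_cast
    nlinarith [(by positivity : (0:ℝ) ≤ (q:ℝ))]
  rw [Fintype.card_prod, Fintype.card_prod, Fintype.card_fin, Fintype.card_fin, Fintype.card_fin]
  push_cast
  calc (b.N (q + 1) : ℝ) * b.N q * m
      ≤ Real.exp (2 * b.κ * (q + 1)) * Real.exp (b.κ * (q + 1)) * Real.exp (m * (q + 1)) := by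
        gcongr
        exact h1.trans (Real.exp_le_exp.2 h4)
    _ = _ := by
        rw [← Real.exp_add, ← Real.exp_add, entropyRate]
        congr 1
        ring

lemma card_width_le (q : ℕ) :
    (Fintype.card (Fin (b.N q)) : ℝ) ≤ Real.exp (b.entropyRate * (q + 1)) := by
  have := b.κ_nonneg
  rw [Fintype.card_fin]
  refine (b.N_le q).trans (Real.exp_le_exp.2 ?_)
  refine mul_le_mul_of_nonneg_right ?_ (by positivity)
  rw [entropyRate]
  linarith [(by positivity : (0:ℝ) ≤ (m:ℝ))]

/-- The rate grows like `2^(q/2)` while second moments decay like `2^(-q)`, so the exponent of the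
moment generating function stays bounded at every level; `scale` is chosen so that `scale² ≥ 4BC`.
-/
lemma sq_rate_mul_le (q : ℕ) {v : ℝ} (hv : v ≤ 4 * b.B * b.C * (1 / 2) ^ q) :
    (√2 ^ q / b.scale) ^ 2 * v ≤ 1 := by
  have hD := b.scale_pos
  have hB := b.B_nonneg
  have hC := b.C_nonneg
  have h1 : (√2 ^ q) ^ 2 = 2 ^ q := by
    rw [← pow_mul, mul_comm, pow_mul, Real.sq_sqrt (by norm_num)]
  rw [div_pow, h1, div_mul_eq_mul_div, div_le_one (by positivity)]
  calc (2 : ℝ) ^ q * v ≤ 2 ^ q * (4 * b.B * b.C * (1 / 2) ^ q) := by gcongr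
    _ = 4 * b.B * b.C * (2 * (1 / 2)) ^ q := by rw [mul_pow]; ring
    _ = 4 * b.B * b.C := by norm_num
    _ ≤ b.scale ^ 2 := by
      have : 0 ≤ b.B * b.C := by positivity
      unfold scale
      nlinarith

lemma exists_bound_of_exp_moment {Ω ι : Type*} [MeasurableSpace Ω] {Q : Measure Ω}
    [IsProbabilityMeasure Q] [Fintype ι] (q : ℕ) (x : ι → Ω → ℝ) (hx : ∀ i, Measurable (x i))
    (hcard : (Fintype.card ι : ℝ) ≤ Real.exp (b.entropyRate * (q + 1)))
    (h : ∀ i r, |r| = √2 ^ q / b.scale → Integrable (fun ω => Real.exp (r * x i ω)) Q ∧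
      ∫ ω, Real.exp (r * x i ω) ∂Q ≤ Real.exp 1) :
    ∃ Z : Ω → ℝ, Measurable Z ∧ Integrable Z Q ∧ (∀ ω, 0 ≤ Z ω) ∧ ∫ ω, Z ω ∂Q ≤ b.linkBound q ∧
      ∀ i ω, |x i ω| ≤ Z ω := by
  have hD := b.scale_pos
  have hr : 0 < √2 ^ q / b.scale := by positivity
  have he := b.entropyRate_nonneg
  obtain ⟨Z, h1, h2, h3, h4, h5⟩ := exists_integrable_bound_of_exp_moment x hr
    (show 0 ≤ b.entropyRate * (q + 1) by positivity) (Real.exp_pos 1).le hx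
    (fun i => (h i _ (abs_of_pos hr)).1) (fun i => (h i _ (by rw [abs_neg, abs_of_pos hr])).1)
    (fun i => (h i _ (abs_of_pos hr)).2) (fun i => (h i _ (by rw [abs_neg, abs_of_pos hr])).2) hcard
  refine ⟨Z, h1, h2, h3, h5.trans (le_of_eq ?_), h4⟩
  rw [linkBound, inv_div, inv_pow]
  ring

variable [IsProbabilityMeasure P]

lemma memLp_coord (b : BracketSystem P F) (f : F) (l : Fin m) (p : ℝ≥0∞) :
    MemLp (fun x => f.1 x l) p P :=
  MemLp.of_bound (b.measurable_coord f l).aestronglyMeasurable b.B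
    (ae_of_all _ (b.abs_coord_le f l))

lemma integrable_width (q i) : Integrable (b.width q i) P :=
  Integrable.of_bound (b.measurable_width q i).aestronglyMeasurable b.B (ae_of_all _ fun x => by
    rw [Real.norm_eq_abs, abs_of_nonneg (b.width_nonneg q i x)]
    exact b.width_le q i x)

/-- For a bounded function the second moment is controlled by the first, which is how `L¹` brackets
of size `2^(-q)` give an `L²` size of order `2^(-q/2)`. -/
lemma integral_sq_link_le (q : ℕ) (i) :
    ∫ x, b.link q i x ^ 2 ∂P ≤ 4 * b.B * b.C * (1 / 2) ^ q := by
  have hB := b.B_nonneg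
  have hC := b.C_nonneg
  have h : ∀ x, b.link q i x ^ 2 ≤ 2 * b.B * (b.width (q + 1) i.1.1 x + b.width q i.1.2 x) := by
    intro x
    rw [← sq_abs, sq]
    exact mul_le_mul (b.abs_link_le_two_mul q i x) (b.abs_link_le q i x) (abs_nonneg _)
      (by positivity)
  have h1 := integral_mono_of_nonneg (μ := P) (ae_of_all _ fun x => sq_nonneg (b.link q i x))
    (((b.integrable_width (q + 1) i.1.1).add (b.integrable_width q i.1.2)).const_mul (2 * b.B))
    (ae_of_all _ h)
  refine h1.trans ?_
  rw [integral_const_mul]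
  simp only [Pi.add_apply]
  rw [integral_add (b.integrable_width _ _) (b.integrable_width _ _)]
  have h2 := b.integral_width_le (q + 1) i.1.1
  have h3 := b.integral_width_le q i.1.2
  have h4 : b.C * (1 / 2 : ℝ) ^ (q + 1) ≤ b.C * (1 / 2) ^ q := by
    rw [pow_succ]
    have : 0 ≤ b.C * (1 / 2 : ℝ) ^ q := by positivity
    linarith
  calc 2 * b.B * _ ≤ 2 * b.B * (b.C * (1 / 2) ^ q + b.C * (1 / 2) ^ q) := by gcongr; linarith
    _ = _ := by ring

lemma integral_sq_width_le (q : ℕ) (i) :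
    ∫ x, b.width q i x ^ 2 ∂P ≤ 4 * b.B * b.C * (1 / 2) ^ q := by
  have hB := b.B_nonneg
  have hC := b.C_nonneg
  have h1 := integral_mono_of_nonneg (μ := P) (ae_of_all _ fun x => sq_nonneg (b.width q i x))
    ((b.integrable_width q i).const_mul b.B) (ae_of_all _ fun x => by
      simp only [sq]
      exact mul_le_mul_of_nonneg_right (b.width_le q i x) (b.width_nonneg q i x))
  refine h1.trans ?_
  rw [integral_const_mul]
  have h2 : b.B * ∫ x, b.width q i x ∂P ≤ b.B * (b.C * (1 / 2) ^ q) :=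
    mul_le_mul_of_nonneg_left (b.integral_width_le q i) hB
  have h3 : 0 ≤ b.B * (b.C * (1 / 2) ^ q) := by positivity
  linarith

/-- The condition `2 ^ q ≤ n` puts the rate `√2 ^ q / scale` in the range of the Bernstein bound,
because `scale ≥ 4B`. It guards only the last conclusion, so that `Z` can be chosen for all levels
at once, with `Z = 0` at the excluded ones. -/
lemma exists_scalarEmpirical_bound {ι : Type*} [Fintype ι] (q n : ℕ) (g : ι → S → ℝ)
    (hcard : (Fintype.card ι : ℝ) ≤ Real.exp (b.entropyRate * (q + 1)))
    (hg : ∀ i, Measurable (g i)) (hgB : ∀ i x, |g i x| ≤ 2 * b.B)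
    (hg2 : ∀ i, ∫ x, g i x ^ 2 ∂P ≤ 4 * b.B * b.C * (1 / 2) ^ q) :
    ∃ Z : (ℕ → S) → ℝ, Measurable Z ∧ Integrable Z (Measure.infinitePi fun _ : ℕ => P) ∧
      (∀ X, 0 ≤ Z X) ∧ ∫ X, Z X ∂(Measure.infinitePi fun _ : ℕ => P) ≤ b.linkBound q ∧
      (2 ^ q ≤ n → ∀ i X, |scalarEmpirical P n (g i) X| ≤ Z X) := by
  by_cases hn : 2 ^ q ≤ n
  swap
  · exact ⟨fun _ => 0, measurable_const, integrable_zero _ _ _, fun _ => le_rfl,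
      by simpa using b.linkBound_nonneg q, fun h => absurd h hn⟩
  obtain ⟨Z, h1, h2, h3, h4, h5⟩ := b.exists_bound_of_exp_moment
    (Q := Measure.infinitePi fun _ : ℕ => P) q (fun i => scalarEmpirical P n (g i))
    (fun i => measurable_scalarEmpirical (hg i)) hcard fun i r hr => by
      have hD := b.scale_pos
      have hs : √2 ^ q ≤ √(n : ℝ) := by
        refine Real.le_sqrt_of_sq_le ?_
        rw [← pow_mul, mul_comm, pow_mul, Real.sq_sqrt (by norm_num)]
        exact_mod_cast hn
      have hB : 2 * (2 * b.B) ≤ b.scale := by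
        have hB := b.B_nonneg
        have hC := b.C_nonneg
        have : 0 ≤ b.B * b.C := by positivity
        unfold scale
        linarith
      have h := integral_exp_scalarEmpirical_le (P := P) (r := r) (hg i) (hgB i)
        (lt_of_lt_of_le (by positivity) hn) (by
          rw [hr]
          calc √2 ^ q / b.scale * (2 * (2 * b.B)) ≤ √2 ^ q / b.scale * b.scale := by gcongr
            _ = √2 ^ q := by field_simp
            _ ≤ _ := hs)
      refine ⟨h.1, h.2.trans (Real.exp_le_exp.2 ?_)⟩
      rw [← sq_abs, hr]
      exact b.sq_rate_mul_le q (hg2 i)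
  exact ⟨Z, h1, h2, h3, h4, fun _ => h5⟩

open ProbabilityTheory in
lemma exists_isonormal_bound {Ω : Type*} [MeasurableSpace Ω] {Q : Measure Ω}
    [IsProbabilityMeasure Q] {W : Lp ℝ 2 P →ₗᵢ[ℝ] Lp ℝ 2 Q}
    (hW : ∀ h, Q.map (W h) = gaussianReal 0 (‖h‖₊ ^ 2)) {ι : Type*} [Fintype ι] (q : ℕ)
    (g : ι → S → ℝ) (hcard : (Fintype.card ι : ℝ) ≤ Real.exp (b.entropyRate * (q + 1)))
    (hg : ∀ i, MemLp (g i) 2 P) (hg2 : ∀ i, ∫ x, g i x ^ 2 ∂P ≤ 4 * b.B * b.C * (1 / 2) ^ q) :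
    ∃ Z : Ω → ℝ, Measurable Z ∧ Integrable Z Q ∧ (∀ ω, 0 ≤ Z ω) ∧ ∫ ω, Z ω ∂Q ≤ b.linkBound q ∧
      ∀ i ω, |W (centered P (g i)) ω| ≤ Z ω := by
  refine b.exists_bound_of_exp_moment q (fun i => W (centered P (g i)))
    (fun i => (Lp.stronglyMeasurable _).measurable) hcard fun i r hr => ⟨?_, ?_⟩
  · have h := integrable_exp_mul_gaussianReal (μ := 0) (v := ‖centered P (g i)‖₊ ^ 2) r
    rw [← hW] at h
    exact h.comp_aemeasurable (Lp.aestronglyMeasurable _).aemeasurable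
  · have h := mgf_gaussianReal (hW (centered P (g i))) r
    rw [mgf] at h
    rw [h]
    refine Real.exp_le_exp.2 ?_
    have h1 := b.sq_rate_mul_le q ((norm_sq_centered_le (hg i)).trans (hg2 i))
    rw [← hr, sq_abs] at h1
    push_cast
    nlinarith [sq_nonneg r, sq_nonneg ‖centered P (g i)‖]

end BracketSystem
end

/-! ### From chaining bounds to the Donsker property. -/

section
variable {S : Type*} [MeasurableSpace S] {m : ℕ} {F : Set (S → EuclideanSpace ℝ (Fin m))}
  {P : Measure S}

namespace BracketSystem
variable (b : BracketSystem P F)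

/-- The coordinates of the elements of the `q`-th net. -/
def netCoord (q : ℕ) (i : Fin (b.N q) × Fin m) (x : S) : ℝ :=
  (b.center q i.1).1 x i.2

/-- The approximation of the empirical process that is constant on the cells of the `q`-th net. -/
noncomputable def empiricalApprox (q n : ℕ) (X : ℕ → S) : BoundedFunctions F :=
  stepMap (b.proj q) (WithLp.toLp 2 fun i => scalarEmpirical P n (b.netCoord q i) X)

lemma measurable_empiricalApprox (q n : ℕ) : Measurable (b.empiricalApprox q n) :=
  (stepMap (b.proj q)).continuous.measurable.comp ((WithLp.measurable_toLp 2 _).comp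
    (measurable_pi_lambda _ fun _ => measurable_scalarEmpirical (b.measurable_coord _ _)))

variable [IsProbabilityMeasure P]

lemma empiricalProcess_apply (b : BracketSystem P F) (n : ℕ) (X : ℕ → S) (f : F) (l : Fin m) :
    empiricalProcess P F n X f l = scalarEmpirical P n (fun x => f.1 x l) X := by
  have hi : Integrable f.1 P := Integrable.of_bound (b.measurable f).aestronglyMeasurable b.B
    (ae_of_all _ (b.norm_le f))
  have h := (EuclideanSpace.proj l : EuclideanSpace ℝ (Fin m) →L[ℝ] ℝ).integral_comp_comm hi
  simp only [PiLp.proj_apply] at h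
  simp [empiricalProcess, scalarEmpirical, h]

lemma memℓp_samplePath (b : BracketSystem P F) (n : ℕ) (X : ℕ → S) :
    Memℓp (empiricalProcess P F n X) ∞ := by
  refine memℓp_infty ⟨m * (scalarEmpirical P n (fun _ => b.B) X +
    2 * √(n : ℝ) * ∫ _, b.B ∂P), ?_⟩
  rintro _ ⟨f, rfl⟩
  refine (EuclideanSpace.norm_le_card_mul _ fun l => ?_).trans_eq (by rw [Fintype.card_fin])
  rw [b.empiricalProcess_apply]
  exact abs_scalarEmpirical_le_of_abs_le (integrable_const _) (b.abs_coord_le f l) X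

/-- The maximal inequality for the empirical process. -/
lemma exists_dist_empiricalApprox_le (q n : ℕ) (hq : 2 ^ q ≤ n) :
    ∃ D : (ℕ → S) → ℝ, Measurable D ∧ Integrable D (Measure.infinitePi fun _ : ℕ => P) ∧
      (∀ X, dist (⟨empiricalProcess P F n X, b.memℓp_samplePath n X⟩ : BoundedFunctions F)
        (b.empiricalApprox q n X) ≤ D X) ∧
      ∫ X, D X ∂(Measure.infinitePi fun _ : ℕ => P) ≤
        m * (∑' j, b.linkBound (j + q) + 4 * b.C * (√(n : ℝ))⁻¹) := by
  have hC := b.C_nonneg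
  have hn : 0 < n := lt_of_lt_of_le (by positivity) hq
  have hs : 0 < √(n : ℝ) := Real.sqrt_pos.2 (by exact_mod_cast hn)
  -- The last level satisfies `2^J ≤ n < 2^(J+1)`: the exponential bounds still hold there, and the
  -- remaining bias, at most `2 √n C 2^(-J)`, is already at most `4 C / √n`.
  set J := Nat.log 2 n with hJ
  have hqJ : q ≤ J := Nat.le_log_of_pow_le (by norm_num) hq
  have hJn : 2 ^ J ≤ n := Nat.pow_log_le_self 2 hn.ne'
  have hnJ : (n : ℝ) ≤ 2 * 2 ^ J := by
    have := (Nat.lt_pow_succ_log_self (b := 2) (by norm_num) n).le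
    rw [pow_succ, mul_comm] at this
    exact_mod_cast this
  choose Z hZm hZi hZ0 hZb hZ using fun j => b.exists_scalarEmpirical_bound (P := P) j n (b.link j)
    (b.card_link_le j) (b.measurable_link j) (b.abs_link_le_two_mul j) (b.integral_sq_link_le j)
  obtain ⟨Y, hYm, hYi, hY0, hYb, hY⟩ := b.exists_scalarEmpirical_bound (P := P) J n (b.width J)
    (b.card_width_le J) (b.measurable_width J) (fun i x => by
      rw [abs_of_nonneg (b.width_nonneg J i x)]
      linarith [b.width_le J i x, b.B_nonneg]) (b.integral_sq_width_le J)
  have hsi : Integrable (fun X => ∑ j ∈ Finset.Ico q J, Z j X)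
      (Measure.infinitePi fun _ : ℕ => P) := integrable_finsetSum _ fun j _ => hZi j
  have hrest : Integrable (fun X => Y X + 4 * b.C * (√(n : ℝ))⁻¹)
      (Measure.infinitePi fun _ : ℕ => P) := hYi.add (integrable_const _)
  refine ⟨fun X => m * (∑ j ∈ Finset.Ico q J, Z j X + (Y X + 4 * b.C * (√(n : ℝ))⁻¹)),
    by fun_prop, (hsi.add hrest).const_mul _, fun X => ?_, ?_⟩
  · rw [dist_eq_norm]
    refine norm_boundedFunctions_le ?_ fun f l => ?_
    · exact add_nonneg (Finset.sum_nonneg fun j _ => hZ0 j X) (add_nonneg (hY0 X) (by positivity))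
    · set a : ℕ → ℝ := fun j =>
        scalarEmpirical P n (fun x => (b.center j (b.proj j f)).1 x l) X with ha
      have h1 : |a J - a q| ≤ ∑ j ∈ Finset.Ico q J, Z j X := by
        rw [← Finset.sum_Ico_sub a hqJ]
        refine (Finset.abs_sum_le_sum_abs _ _).trans (Finset.sum_le_sum fun j hj => ?_)
        have h2 := hZ j ((Nat.pow_le_pow_right (by norm_num) (Finset.mem_Ico.1 hj).2.le).trans hJn)
          ((b.proj (j + 1) f, b.proj j f), l) X
        rwa [b.link_proj, scalarEmpirical_sub ((b.memLp_coord _ l 1).integrable le_rfl)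
          ((b.memLp_coord _ l 1).integrable le_rfl)] at h2
      have h2 : |scalarEmpirical P n (fun x => f.1 x l) X - a J| ≤
          Y X + 4 * b.C * (√(n : ℝ))⁻¹ := by
        rw [ha, ← scalarEmpirical_sub ((b.memLp_coord _ l 1).integrable le_rfl)
          ((b.memLp_coord _ l 1).integrable le_rfl)]
        refine (abs_scalarEmpirical_le_of_abs_le (b.integrable_width J (b.proj J f))
          (fun x => ?_) X).trans (add_le_add ((le_abs_self _).trans (hY hJn _ X)) ?_)
        · exact (PiLp.norm_apply_le (f.1 x - (b.center J (b.proj J f)).1 x) l).trans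
            (b.norm_sub_le J f x)
        · calc 2 * √(n : ℝ) * ∫ x, b.width J (b.proj J f) x ∂P
              ≤ 2 * √(n : ℝ) * (b.C * (1 / 2) ^ J) := by
                gcongr
                exact b.integral_width_le J _
            _ = 2 * b.C * (√(n : ℝ))⁻¹ * (√(n : ℝ) ^ 2 / 2 ^ J) := by
                rw [one_div, inv_pow]
                field_simp
            _ ≤ 2 * b.C * (√(n : ℝ))⁻¹ * 2 := by
                rw [Real.sq_sqrt (by positivity)]
                gcongr
                rw [div_le_iff₀ (by positivity)]
                exact hnJ
            _ = _ := by ring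
      change |(empiricalProcess P F n X f l) - a q| ≤ _
      rw [b.empiricalProcess_apply]
      have h3 := abs_sub_le (scalarEmpirical P n (fun x => f.1 x l) X) (a J) (a q)
      linarith
  · rw [integral_const_mul, integral_add hsi hrest, integral_add hYi (integrable_const _),
      integral_finsetSum _ fun j _ => hZi j]
    simp only [integral_const, probReal_univ, one_smul]
    rw [← add_assoc]
    refine mul_le_mul_of_nonneg_left (add_le_add ?_ le_rfl) (by positivity)
    -- The links use the levels below `J`; the term `J` pays for `Y`, the fluctuation of the final
    -- brackets.
    have hsum : ∑ j ∈ Finset.Ico q (J + 1), b.linkBound j ≤ ∑' j, b.linkBound (j + q) := by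
      rw [Finset.sum_Ico_eq_sum_range]
      simp_rw [add_comm q]
      exact ((summable_nat_add_iff q).2 b.summable_linkBound).sum_le_tsum _
        fun j _ => b.linkBound_nonneg _
    rw [Finset.sum_Ico_succ_top hqJ] at hsum
    exact (add_le_add (Finset.sum_le_sum fun j _ => hZb j) hYb).trans hsum

section Gaussian
open ProbabilityTheory
variable {Ω : Type*} [MeasurableSpace Ω] {Q : Measure Ω} [IsProbabilityMeasure Q]

/-- The Gaussian counterpart of `BracketSystem.empiricalApprox`. -/
noncomputable def gaussianApprox (W : Lp ℝ 2 P →ₗᵢ[ℝ] Lp ℝ 2 Q) (q : ℕ) (ω : Ω) :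
    BoundedFunctions F :=
  stepMap (b.proj q) (WithLp.toLp 2 fun i => W (centered P (b.netCoord q i)) ω)

variable (W : Lp ℝ 2 P →ₗᵢ[ℝ] Lp ℝ 2 Q)

lemma memLp_gaussianApprox (q : ℕ) : MemLp (b.gaussianApprox W q) 1 Q := by
  have hm : Measurable fun ω => (WithLp.toLp 2 fun i => W (centered P (b.netCoord q i)) ω :
      EuclideanSpace ℝ (Fin (b.N q) × Fin m)) :=
    (WithLp.measurable_toLp 2 _).comp
      (measurable_pi_lambda _ fun i => (Lp.stronglyMeasurable _).measurable)
  have hi : Integrable (fun ω => (WithLp.toLp 2 fun i => W (centered P (b.netCoord q i)) ω :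
      EuclideanSpace ℝ (Fin (b.N q) × Fin m))) Q := by
    have hb : Integrable (fun ω => Fintype.card (Fin (b.N q) × Fin m) *
        ∑ i, |W (centered P (b.netCoord q i)) ω|) Q :=
      (integrable_finsetSum _ fun i _ =>
        ((Lp.memLp (W (centered P (b.netCoord q i)))).integrable (by norm_num)).abs).const_mul _
    refine hb.mono' hm.aestronglyMeasurable (ae_of_all _ fun ω => ?_)
    exact EuclideanSpace.norm_le_card_mul _ fun i => Finset.single_le_sum
      (f := fun i => |W (centered P (b.netCoord q i)) ω|) (fun i _ => abs_nonneg _)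
      (Finset.mem_univ i)
  exact memLp_one_iff_integrable.2 ((stepMap (b.proj q)).integrable_comp hi)

lemma integral_norm_gaussianApprox_sub_le {W : Lp ℝ 2 P →ₗᵢ[ℝ] Lp ℝ 2 Q}
    (hW : ∀ h, Q.map (W h) = gaussianReal 0 (‖h‖₊ ^ 2)) (q : ℕ) :
    ∫ ω, ‖b.gaussianApprox W q ω - b.gaussianApprox W (q + 1) ω‖ ∂Q ≤ m * b.linkBound q := by
  obtain ⟨Z, -, hZi, hZ0, hZb, hZ⟩ := b.exists_isonormal_bound hW q (b.link q) (b.card_link_le q)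
    (fun i => MemLp.of_bound (b.measurable_link q i).aestronglyMeasurable (2 * b.B)
      (ae_of_all _ (b.abs_link_le_two_mul q i))) (b.integral_sq_link_le q)
  -- Subtraction in `Lp` is pointwise only almost everywhere; one null set suffices because the nets
  -- are finite.
  have hae : ∀ᵐ ω ∂Q, ∀ i : (Fin (b.N (q + 1)) × Fin (b.N q)) × Fin m,
      (W (centered P (b.netCoord (q + 1) (i.1.1, i.2))) -
        W (centered P (b.netCoord q (i.1.2, i.2))) : Lp ℝ 2 Q) ω =
      W (centered P (b.netCoord (q + 1) (i.1.1, i.2))) ω -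
        W (centered P (b.netCoord q (i.1.2, i.2))) ω :=
    ae_all_iff.2 fun i => Lp.coeFn_sub _ _
  refine (integral_mono_of_nonneg (ae_of_all _ fun ω => norm_nonneg _) (hZi.const_mul (m : ℝ))
    ?_).trans ?_
  · filter_upwards [hae] with ω hω
    refine norm_boundedFunctions_le (hZ0 ω) fun f l => ?_
    have h1 := hZ ((b.proj (q + 1) f, b.proj q f), l) ω
    rw [b.link_proj, centered_sub (b.memLp_coord _ l 2) (b.memLp_coord _ l 2), map_sub] at h1
    have h2 := hω ((b.proj (q + 1) f, b.proj q f), l)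
    change |W (centered P (b.netCoord q (b.proj q f, l))) ω -
      W (centered P (b.netCoord (q + 1) (b.proj (q + 1) f, l))) ω| ≤ Z ω
    rw [abs_sub_comm]
    exact (congrArg abs h2).symm.trans_le h1
  · rw [integral_const_mul]
    gcongr

/-- Summable increments make the step processes Cauchy in the complete space `L¹(Q; ℓ^∞(F))`. The
limit is strongly measurable by construction, so no version of the Gaussian process with regular
paths has to be built. -/
lemma exists_gaussian_limit {W : Lp ℝ 2 P →ₗᵢ[ℝ] Lp ℝ 2 Q}
    (hW : ∀ h, Q.map (W h) = gaussianReal 0 (‖h‖₊ ^ 2)) :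
    ∃ u : Ω → BoundedFunctions F, StronglyMeasurable u ∧ Integrable u Q ∧
      Tendsto (fun q => ∫ ω, ‖b.gaussianApprox W q ω - u ω‖ ∂Q) atTop (𝓝 0) := by
  set v : ℕ → Lp (BoundedFunctions F) 1 Q := fun q => (b.memLp_gaussianApprox W q).toLp with hv
  have hdist : ∀ q, dist (v q) (v (q + 1)) ≤ m * b.linkBound q := fun q => by
    refine le_trans (le_of_eq ?_) (b.integral_norm_gaussianApprox_sub_le hW q)
    rw [dist_eq_norm, L1.norm_eq_integral_norm]
    refine integral_congr_ae ?_
    filter_upwards [Lp.coeFn_sub (v q) (v (q + 1)), (b.memLp_gaussianApprox W q).coeFn_toLp,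
      (b.memLp_gaussianApprox W (q + 1)).coeFn_toLp] with ω h1 h2 h3
    rw [h1, Pi.sub_apply, h2, h3]
  obtain ⟨u, hu⟩ := cauchySeq_tendsto_of_complete
    (cauchySeq_of_dist_le_of_summable _ hdist (b.summable_linkBound.mul_left _))
  refine ⟨u, Lp.stronglyMeasurable u, L1.integrable_coeFn u, ?_⟩
  rw [tendsto_iff_dist_tendsto_zero] at hu
  refine hu.congr fun q => ?_
  rw [dist_eq_norm, L1.norm_eq_integral_norm]
  refine integral_congr_ae ?_
  filter_upwards [Lp.coeFn_sub (v q) u, (b.memLp_gaussianApprox W q).coeFn_toLp] with ω h1 h2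
  rw [h1, Pi.sub_apply, h2]

end Gaussian

theorem isDonsker (b : BracketSystem P F) : IsDonsker P F := by
  refine ⟨fun f hf => ⟨b.measurable ⟨f, hf⟩, MemLp.of_bound
    (b.measurable ⟨f, hf⟩).aestronglyMeasurable b.B (ae_of_all _ (b.norm_le ⟨f, hf⟩))⟩,
    b.memℓp_samplePath, ?_⟩
  obtain ⟨Ω, mΩ, Q, hQ, W, hW⟩ := exists_isonormal (H := Lp ℝ 2 P)
  obtain ⟨u, hum, hui, hu⟩ := b.exists_gaussian_limit hW
  have hL : IsProbabilityMeasure (Q.map u) :=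
    Measure.isProbabilityMeasure_map hum.measurable.aemeasurable
  have hgm : ∀ q, AEMeasurable (b.gaussianApprox W q) Q :=
    fun q => (b.memLp_gaussianApprox W q).1.aemeasurable
  refine ⟨Q.map u, hL, isTightMeasureSet_map_of_stronglyMeasurable hum, ?_⟩
  refine tendsto_outerExpectation_of_approx _ (fun q n => b.empiricalApprox q n)
    (fun q => Q.map (b.gaussianApprox W q)) _ b.measurable_empiricalApprox ?_ ?_ ?_
  · intro q φ
    rw [integral_map (hgm q) φ.continuous.measurable.aestronglyMeasurable]
    exact tendsto_integral_scalarEmpirical_vector W hW (b.netCoord q)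
      (fun i => b.measurable_coord _ _) (fun i => b.memLp_coord _ _ 2)
      (φ.compContinuous ⟨_, (stepMap (b.proj q)).continuous⟩)
  · intro φ K hφ
    have hint : ∀ {v : Ω → BoundedFunctions F}, AEMeasurable v Q →
        Integrable (fun ω => φ (v ω)) Q := fun hv =>
      Integrable.of_bound (φ.continuous.measurable.comp_aemeasurable hv).aestronglyMeasurable ‖φ‖
        (ae_of_all _ fun ω => φ.norm_coe_le_norm _)
    rw [integral_map hum.measurable.aemeasurable φ.continuous.measurable.aestronglyMeasurable]
    rw [tendsto_iff_dist_tendsto_zero]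
    refine squeeze_zero (fun _ => dist_nonneg) (fun q => ?_) (by simpa using hu.const_mul (K : ℝ))
    rw [integral_map (hgm q) φ.continuous.measurable.aestronglyMeasurable, dist_eq_norm,
      ← integral_sub (hint (hgm q)) (hint hum.measurable.aemeasurable), ← integral_const_mul]
    refine norm_integral_le_of_norm_le
      ((((b.memLp_gaussianApprox W q).integrable le_rfl).sub hui).norm.const_mul _)
      (ae_of_all _ fun ω => ?_)
    rw [← dist_eq_norm, ← dist_eq_norm]
    exact hφ.dist_le_mul _ _
  · intro ε hε
    -- First `q` makes the tail of the chaining series small, then `n`, depending on `q`, makes the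
    -- bias small.
    have h1 : Tendsto (fun q => m * ∑' j, b.linkBound (j + q)) atTop (𝓝 0) := by
      simpa using (tendsto_sum_nat_add b.linkBound).const_mul (m : ℝ)
    have h2 : Tendsto (fun n : ℕ => m * (4 * b.C * (√(n : ℝ))⁻¹)) atTop (𝓝 0) := by
      have : Tendsto (fun n : ℕ => (√(n : ℝ))⁻¹) atTop (𝓝 0) :=
        tendsto_inv_atTop_zero.comp (Real.tendsto_sqrt_atTop.comp tendsto_natCast_atTop_atTop)
      simpa using (this.const_mul (4 * b.C)).const_mul (m : ℝ)
    filter_upwards [h1.eventually_lt_const (half_pos hε)] with q hq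
    filter_upwards [h2.eventually_lt_const (half_pos hε), eventually_ge_atTop (2 ^ q)] with n hn hqn
    obtain ⟨D, hD1, hD2, hD3, hD4⟩ := b.exists_dist_empiricalApprox_le q n hqn
    refine ⟨D, hD1, hD2, hD3, hD4.trans ?_⟩
    rw [mul_add]
    linarith

end BracketSystem
end

/-! ### The optimal centers are distinct -/

lemma ae_norm_le_of_isBounded_support {E : Type*} [NormedAddCommGroup E] [MeasurableSpace E]
    [SecondCountableTopology E] {P : Measure E} (h : Bornology.IsBounded P.support) :
    ∃ R : ℝ, 0 < R ∧ ∀ᵐ x ∂P, ‖x‖ ≤ R := by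
  obtain ⟨R, hR, h⟩ := h.exists_pos_norm_le
  exact ⟨R, hR, by filter_upwards [Measure.support_mem_ae (μ := P)] with x hx using h x hx⟩

/-- If `μ i = μ j` with `i ≠ j`, moving the redundant `μ j` to a point `v` outside the range of `μ`
does not raise the risk. The result is another minimizer that is no relabelling of `μ`. Such a `v`
exists because the space is infinite for `d ≥ 1`. -/
lemma IsUniqueKMeansSolution.injective {k d : ℕ} (hd : 1 ≤ d)
    {P : Measure (EuclideanSpace ℝ (Fin d))} [IsProbabilityMeasure P] {R : ℝ}
    (hR : ∀ᵐ x ∂P, ‖x‖ ≤ R) {μ : Fin k → EuclideanSpace ℝ (Fin d)}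
    (hμ : IsUniqueKMeansSolution P μ) : Function.Injective μ := by
  intro i j hij
  by_contra hne
  have : Nonempty (Fin d) := ⟨⟨0, hd⟩⟩
  have : Nonempty (Fin k) := ⟨i⟩
  obtain ⟨v, hv⟩ := (Set.finite_range μ).infinite_compl.nonempty
  have hbdd : ∀ (ν : Fin k → EuclideanSpace ℝ (Fin d)) x,
      BddBelow (Set.range fun j => ‖x - ν j‖ ^ 2) := fun ν x => (Set.finite_range _).bddBelow
  have h0 : ∀ (ν : Fin k → EuclideanSpace ℝ (Fin d)) x, 0 ≤ ⨅ j, ‖x - ν j‖ ^ 2 :=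
    fun ν x => le_ciInf fun j => sq_nonneg _
  have hint : Integrable (fun x => ⨅ j, ‖x - μ j‖ ^ 2) P := by
    refine Integrable.of_bound (Measurable.iInf fun j => by fun_prop).aestronglyMeasurable
      ((R + ‖μ i‖) ^ 2) ?_
    filter_upwards [hR] with x hx
    rw [Real.norm_eq_abs, abs_of_nonneg (h0 μ x)]
    refine (ciInf_le (hbdd μ x) i).trans ?_
    have := norm_sub_le x (μ i)
    gcongr
    linarith
  have hle : kMeansRisk P (Function.update μ j v) ≤ kMeansRisk P μ := by
    refine integral_mono_of_nonneg (ae_of_all _ (h0 _)) hint (ae_of_all _ fun x => ?_)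
    refine le_ciInf fun l => ?_
    by_cases hl : l = j
    · refine (ciInf_le (hbdd _ x) i).trans (le_of_eq ?_)
      rw [Function.update_of_ne hne, hl, hij]
    · refine (ciInf_le (hbdd _ x) l).trans (le_of_eq ?_)
      rw [Function.update_of_ne hl]
  obtain ⟨σ, hσ⟩ := hμ.unique _ (le_antisymm hle (hμ.isMin _))
  refine hv ⟨σ j, ?_⟩
  simpa using (congrFun hσ j).symm

/-! ### The mass near the boundaries of the cells -/

/-- Fubini replaces a rotation of coordinates. The slab is translated by `s w / ‖w‖` for `s` in `[0,
1]`, which preserves its volume and keeps it in the ball of radius `R + 1`. For a fixed point, the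
parameters `s` whose translate contains it lie in an interval of length `2t / ‖w‖`. -/
lemma volume_slab_le {d : ℕ} {w : EuclideanSpace ℝ (Fin d)} (hw : w ≠ 0) (R β : ℝ) {t : ℝ} :
    volume {x : EuclideanSpace ℝ (Fin d) | ‖x‖ ≤ R ∧ |inner ℝ w x + β| ≤ t} ≤
      volume (Metric.closedBall (0 : EuclideanSpace ℝ (Fin d)) (R + 1)) *
        ENNReal.ofReal (2 * t / ‖w‖) := by
  have hw' : 0 < ‖w‖ := norm_pos_iff.2 hw
  set A : Set (ℝ × EuclideanSpace ℝ (Fin d)) :=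
    {p | p.1 ∈ Set.Icc (0 : ℝ) 1 ∧ ‖p.2‖ ≤ R + 1 ∧ |inner ℝ w p.2 - p.1 * ‖w‖ + β| ≤ t} with hA
  have hAm : MeasurableSet A := by
    have h : A = Prod.fst ⁻¹' Set.Icc (0 : ℝ) 1 ∩ ({p | ‖p.2‖ ≤ R + 1} ∩
        {p | |inner ℝ w p.2 - p.1 * ‖w‖ + β| ≤ t}) := by
      ext p
      rfl
    rw [h]
    exact (measurableSet_Icc.preimage measurable_fst).inter
      ((measurableSet_le (by fun_prop) measurable_const).inter
        (measurableSet_le (by fun_prop) measurable_const))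
  calc volume {x : EuclideanSpace ℝ (Fin d) | ‖x‖ ≤ R ∧ |inner ℝ w x + β| ≤ t}
      = ∫⁻ _ in Set.Icc (0 : ℝ) 1,
          volume {x : EuclideanSpace ℝ (Fin d) | ‖x‖ ≤ R ∧ |inner ℝ w x + β| ≤ t} := by simp
    _ ≤ ∫⁻ s in Set.Icc (0 : ℝ) 1, volume (Prod.mk s ⁻¹' A) := by
        refine setLIntegral_mono (measurable_measure_prodMk_left hAm) fun s hs => ?_
        rw [← measure_preimage_add_right volume ((s / ‖w‖) • w) (Prod.mk s ⁻¹' A)]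
        refine measure_mono fun x hx => ⟨hs, ?_, ?_⟩
        · refine (norm_add_le _ _).trans (add_le_add hx.1 ?_)
          rw [norm_smul, norm_div, norm_norm, div_mul_cancel₀ _ hw'.ne', Real.norm_eq_abs,
            abs_of_nonneg hs.1]
          exact hs.2
        · have h1 : inner ℝ w (x + (s / ‖w‖) • w) = inner ℝ w x + s * ‖w‖ := by
            rw [inner_add_right, inner_smul_right, real_inner_self_eq_norm_sq]
            field_simp
          dsimp only
          rw [h1, add_sub_cancel_right]
          exact hx.2
    _ ≤ ∫⁻ s, volume (Prod.mk s ⁻¹' A) := setLIntegral_le_lintegral _ _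
    _ = ∫⁻ x, volume ((fun s => (s, x)) ⁻¹' A) := by
        rw [← Measure.prod_apply hAm, Measure.prod_apply_symm hAm]
    _ ≤ ∫⁻ x, (Metric.closedBall (0 : EuclideanSpace ℝ (Fin d)) (R + 1)).indicator
          (fun _ => ENNReal.ofReal (2 * t / ‖w‖)) x := by
        refine lintegral_mono fun x => ?_
        by_cases hx : ‖x‖ ≤ R + 1
        · rw [Set.indicator_of_mem (by simpa using hx)]
          refine (measure_mono (t := Set.Icc ((inner ℝ w x + β - t) / ‖w‖)
            ((inner ℝ w x + β + t) / ‖w‖)) ?_).trans (le_of_eq ?_)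
          · rintro s ⟨-, -, hs⟩
            rw [abs_le] at hs
            dsimp only at hs
            rw [Set.mem_Icc, div_le_iff₀ hw', le_div_iff₀ hw']
            constructor <;> linarith [hs.1, hs.2]
          · rw [Real.volume_Icc]
            congr 1
            ring
        · have : (fun s : ℝ => (s, x)) ⁻¹' A = ∅ := by
            ext s
            simp [hA, hx]
          simp [this]
    _ = _ := by
        rw [lintegral_indicator_const Metric.isClosed_closedBall.measurableSet, mul_comm]

/-- The points with two centers at almost the same distance. -/
def nearTies {k d : ℕ} (ν : Fin k → EuclideanSpace ℝ (Fin d)) (η : ℝ) :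
    Set (EuclideanSpace ℝ (Fin d)) :=
  {x | ∃ i j, i ≠ j ∧ |dist x (ν i) - dist x (ν j)| ≤ 2 * η}

lemma measurableSet_nearTies {k d : ℕ} (ν : Fin k → EuclideanSpace ℝ (Fin d)) (η : ℝ) :
    MeasurableSet (nearTies ν η) := by
  have : nearTies ν η = ⋃ i, ⋃ j, ⋃ (_ : i ≠ j), {x | |dist x (ν i) - dist x (ν j)| ≤ 2 * η} := by
    ext x
    simp [nearTies]
  rw [this]
  refine MeasurableSet.iUnion fun i => MeasurableSet.iUnion fun j => MeasurableSet.iUnion fun _ => ?_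
  exact measurableSet_le (by fun_prop) measurable_const

/-- Each distance to a center moves by at most `η`, so gaps larger than `2η` keep their sign. Cells
depend only on the strict order of the distances, tie rule included. -/
lemma cellIndicator_eq_of_notMem_nearTies {k d : ℕ} {μ ν : Fin k → EuclideanSpace ℝ (Fin d)}
    {η : ℝ} (h : dist μ ν ≤ η) {x : EuclideanSpace ℝ (Fin d)} (hx : x ∉ nearTies ν η) :
    cellIndicator μ x = cellIndicator ν x := by
  have h1 : ∀ i, |dist x (μ i) - dist x (ν i)| ≤ η := fun i => by
    rw [dist_comm x, dist_comm x]
    exact (abs_dist_sub_le _ _ _).trans ((dist_le_pi_dist μ ν i).trans h)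
  have h2 : ∀ i j, i ≠ j → 2 * η < |dist x (ν i) - dist x (ν j)| := fun i j hij => by
    by_contra hc
    exact hx ⟨i, j, hij, not_lt.1 hc⟩
  have hlt : ∀ i j, dist x (μ i) < dist x (μ j) ↔ dist x (ν i) < dist x (ν j) := by
    intro i j
    rcases eq_or_ne i j with rfl | hij
    · simp
    have h3 := abs_le.1 (h1 i)
    have h4 := abs_le.1 (h1 j)
    have h5 := h2 i j hij
    rcases lt_abs.1 h5 with h5 | h5
    · exact ⟨fun h => by linarith, fun h => by linarith [dist_nonneg.trans ‹dist μ ν ≤ η›]⟩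
    · exact ⟨fun h => by linarith [dist_nonneg.trans ‹dist μ ν ≤ η›], fun h => by linarith⟩
  have hcell : ∀ j, x ∈ voronoiCell μ j ↔ x ∈ voronoiCell ν j := by
    intro j
    simp only [voronoiCell, Set.mem_ofPred_eq, ← not_lt, hlt]
  unfold cellIndicator
  congr 1
  funext l
  classical exact if_congr (hcell _) rfl rfl

/-- The difference of squared distances to two centers is affine in `x`, and it equals the
difference of the distances times their sum. The sum is at most `4R`, so a near tie lies in a slab
with bound `8Rη` and normal of length at least `2r`. The constant does not depend on `ν`. -/
lemma exists_measure_nearTies_le {k d : ℕ} {P : Measure (EuclideanSpace ℝ (Fin d))}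
    [IsProbabilityMeasure P] {p : EuclideanSpace ℝ (Fin d) → ℝ} {M R r : ℝ} (hp : ∀ x, p x ≤ M)
    (hM : 0 ≤ M) (hP : P = volume.withDensity fun x => ENNReal.ofReal (p x)) (hr : 0 < r)
    (hR : 0 < R) (hPR : ∀ᵐ x ∂P, ‖x‖ ≤ R) :
    ∃ C : ℝ, 0 ≤ C ∧ ∀ ν : Fin k → EuclideanSpace ℝ (Fin d), (∀ i, ‖ν i‖ ≤ R) →
      (∀ i j, i ≠ j → r ≤ dist (ν i) (ν j)) → ∀ η : ℝ, 0 ≤ η → P.real (nearTies ν η) ≤ C * η := by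
  set V := (volume (Metric.closedBall (0 : EuclideanSpace ℝ (Fin d)) (R + 1))).toReal with hV
  have hdens : ∀ s : Set (EuclideanSpace ℝ (Fin d)), MeasurableSet s →
      P s ≤ ENNReal.ofReal M * volume s := by
    intro s hs
    rw [hP, withDensity_apply _ hs, ← setLIntegral_const]
    exact lintegral_mono fun x => ENNReal.ofReal_le_ofReal (hp x)
  refine ⟨∑ _ : Fin k, ∑ _ : Fin k, M * (V * (8 * R / r)), by positivity,
    fun ν hν hsep η hη => ?_⟩
  set T : Fin k → Fin k → Set (EuclideanSpace ℝ (Fin d)) := fun i j =>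
    {x | ‖x‖ ≤ R ∧ i ≠ j ∧ |dist x (ν i) - dist x (ν j)| ≤ 2 * η} with hT
  have hTle : ∀ i j, P.real (T i j) ≤ M * (V * (8 * R / r)) * η := by
    intro i j
    by_cases hij : i = j
    · simp only [hT, hij, ne_eq, not_true_eq_false, false_and, and_false, Set.ofPred_false,
        measureReal_empty]
      positivity
    have hsub : T i j ⊆ {x | ‖x‖ ≤ R ∧
        |inner ℝ ((2 : ℝ) • (ν j - ν i)) x + (‖ν i‖ ^ 2 - ‖ν j‖ ^ 2)| ≤ 8 * R * η} := by
      rintro x ⟨hx, -, hx2⟩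
      refine ⟨hx, ?_⟩
      have h1 : inner ℝ ((2 : ℝ) • (ν j - ν i)) x + (‖ν i‖ ^ 2 - ‖ν j‖ ^ 2) =
          (dist x (ν i) - dist x (ν j)) * (dist x (ν i) + dist x (ν j)) := by
        rw [dist_eq_norm, dist_eq_norm, real_inner_smul_left, inner_sub_left,
          real_inner_comm x (ν i), real_inner_comm x (ν j)]
        have h2 := norm_sub_sq_real x (ν i)
        have h3 := norm_sub_sq_real x (ν j)
        linarith
      have h2 : dist x (ν i) + dist x (ν j) ≤ 4 * R := by
        rw [dist_eq_norm, dist_eq_norm]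
        linarith [norm_sub_le x (ν i), norm_sub_le x (ν j), hν i, hν j]
      rw [h1, abs_mul, abs_of_nonneg (a := dist x (ν i) + dist x (ν j)) (by positivity)]
      calc _ ≤ 2 * η * (4 * R) := by gcongr
        _ = _ := by ring
    have hw : r ≤ ‖ν j - ν i‖ := by
      rw [← dist_eq_norm]
      exact hsep j i (Ne.symm hij)
    have hw2 : ‖(2 : ℝ) • (ν j - ν i)‖ = 2 * ‖ν j - ν i‖ := by
      rw [norm_smul]
      norm_num
    have hw0 : (2 : ℝ) • (ν j - ν i) ≠ 0 := by
      rw [← norm_pos_iff, hw2]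
      linarith
    have hmeas : MeasurableSet {x : EuclideanSpace ℝ (Fin d) | ‖x‖ ≤ R ∧
        |inner ℝ ((2 : ℝ) • (ν j - ν i)) x + (‖ν i‖ ^ 2 - ‖ν j‖ ^ 2)| ≤ 8 * R * η} := by
      have h : {x : EuclideanSpace ℝ (Fin d) | ‖x‖ ≤ R ∧
          |inner ℝ ((2 : ℝ) • (ν j - ν i)) x + (‖ν i‖ ^ 2 - ‖ν j‖ ^ 2)| ≤ 8 * R * η} =
          {x | ‖x‖ ≤ R} ∩
            {x | |inner ℝ ((2 : ℝ) • (ν j - ν i)) x + (‖ν i‖ ^ 2 - ‖ν j‖ ^ 2)| ≤ 8 * R * η} := by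
        ext x
        rfl
      rw [h]
      exact (measurableSet_le (by fun_prop) measurable_const).inter
        (measurableSet_le (by fun_prop) measurable_const)
    have h3 : P (T i j) ≤ ENNReal.ofReal (M * (V * (8 * R / r)) * η) := by
      refine (measure_mono hsub).trans ((hdens _ hmeas).trans ?_)
      rw [show M * (V * (8 * R / r)) * η = M * (V * (8 * R / r * η)) by ring,
        ENNReal.ofReal_mul hM]
      gcongr
      refine (volume_slab_le hw0 _ _).trans ?_
      rw [ENNReal.ofReal_mul (by positivity), hV,
        ENNReal.ofReal_toReal (Metric.isBounded_closedBall.measure_lt_top).ne]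
      gcongr
      rw [hw2]
      calc 2 * (8 * R * η) / (2 * ‖ν j - ν i‖) ≤ 2 * (8 * R * η) / (2 * r) := by gcongr
        _ = _ := by field_simp
    exact ENNReal.toReal_le_of_le_ofReal (by positivity) h3
  have hsub : nearTies ν η ≤ᵐ[P] ⋃ i, ⋃ j, T i j := by
    filter_upwards [hPR] with x hx ⟨i, j, h⟩
    exact Set.mem_iUnion₂.2 ⟨i, j, hx, h⟩
  calc P.real (nearTies ν η) ≤ P.real (⋃ i, ⋃ j, T i j) :=
        ENNReal.toReal_mono (measure_ne_top _ _) (measure_mono_ae hsub)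
    _ ≤ ∑ i, ∑ j, P.real (T i j) := (measureReal_iUnion_fintype_le _).trans
        (Finset.sum_le_sum fun i _ => measureReal_iUnion_fintype_le _)
    _ ≤ ∑ _ : Fin k, ∑ _ : Fin k, M * (V * (8 * R / r)) * η := by
        gcongr with i _ j
        exact hTle i j
    _ = _ := by simp_rw [Finset.sum_mul]

/-! ### Nets of bounded sets of centers -/

/-- The coordinates are rounded to a grid and one point of `K` is kept in each occupied grid cell,
so the net lies in `K` itself. The mesh `η / (d + 1)` suffices as the norm is at most `d` times the
largest coordinate. -/
lemma exists_net {k d : ℕ} {K : Set (Fin k → EuclideanSpace ℝ (Fin d))} {R : ℝ}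
    (hR : 0 < R) (hK : ∀ μ ∈ K, ∀ i, ‖μ i‖ ≤ R) :
    ∃ A : ℝ, 0 < A ∧ ∀ η : ℝ, 0 < η → η ≤ 1 → ∃ s : Finset (Fin k → EuclideanSpace ℝ (Fin d)),
      ↑s ⊆ K ∧ (s.card : ℝ) ≤ A * (1 / η) ^ (k * d) ∧ ∀ μ ∈ K, ∃ ν ∈ s, dist μ ν ≤ η := by
  classical
  refine ⟨(2 * R * (d + 1) + 2) ^ (k * d), by positivity, fun η hη hη1 => ?_⟩
  set h := η / (d + 1) with hh
  have hh0 : 0 < h := by positivity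
  set z : (Fin k → EuclideanSpace ℝ (Fin d)) → Fin k → Fin d → ℤ := fun μ i l => ⌊μ i l / h⌋ with hz
  set box : Finset (Fin k → Fin d → ℤ) := Fintype.piFinset fun _ => Fintype.piFinset fun _ =>
    Finset.Icc ⌊-R / h⌋ ⌊R / h⌋ with hbox
  have hzbox : z '' K ⊆ box := by
    rintro _ ⟨μ, hμ, rfl⟩
    simp only [hbox, Finset.mem_coe, Fintype.mem_piFinset, Finset.mem_Icc, hz]
    intro i l
    have := abs_le.1 ((PiLp.norm_apply_le (μ i) l).trans (hK μ hμ i))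
    constructor <;> exact Int.floor_le_floor (by gcongr; first | exact this.1 | exact this.2)
  obtain ⟨s, hsK, hs⟩ := Set.exists_subset_bijOn K z
  have hfin : (z '' K).Finite := box.finite_toSet.subset hzbox
  have hsfin : s.Finite := Set.Finite.of_finite_image (hs.image_eq ▸ hfin) hs.injOn
  refine ⟨hsfin.toFinset, by simpa using hsK, ?_, fun μ hμ => ?_⟩
  · have h1 : hsfin.toFinset.card ≤ box.card := by
      rw [← Set.ncard_eq_toFinset_card s hsfin, ← hs.injOn.ncard_image, hs.image_eq,
        ← Set.ncard_coe_finset box]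
      exact Set.ncard_le_ncard hzbox box.finite_toSet
    have h2 : (box.card : ℝ) = ((Finset.Icc ⌊-R / h⌋ ⌊R / h⌋).card : ℝ) ^ (k * d) := by
      rw [hbox, Fintype.card_piFinset_const, Fintype.card_piFinset_const]
      push_cast
      rw [← pow_mul, mul_comm]
    have h3 : ((Finset.Icc ⌊-R / h⌋ ⌊R / h⌋).card : ℝ) ≤ (2 * R * (d + 1) + 2) * (1 / η) := by
      have h4 : ⌊-R / h⌋ ≤ ⌊R / h⌋ + 1 := by
        have : ⌊-R / h⌋ ≤ ⌊R / h⌋ :=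
          Int.floor_le_floor (div_le_div_of_nonneg_right (by linarith) hh0.le)
        omega
      have h5 : ((Finset.Icc ⌊-R / h⌋ ⌊R / h⌋).card : ℝ) = ⌊R / h⌋ + 1 - ⌊-R / h⌋ := by
        have := Int.card_Icc_of_le _ _ h4
        exact_mod_cast this
      rw [h5]
      have h6 := Int.floor_le (R / h)
      have h7 := Int.lt_floor_add_one (-R / h)
      have h10 : -R / h = -(R / h) := neg_div _ _
      have h8 : R / h = R * (d + 1) * (1 / η) := by
        rw [hh]
        field_simp
      have h9 : 1 ≤ 1 / η := by rw [le_div_iff₀ hη]; linarith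
      have h11 : (2 * R * (d + 1) + 2) * (1 / η) = 2 * (R / h) + 2 * (1 / η) := by
        rw [h8]
        ring
      linarith
    calc (hsfin.toFinset.card : ℝ) ≤ box.card := by exact_mod_cast h1
      _ ≤ ((2 * R * (d + 1) + 2) * (1 / η)) ^ (k * d) := by rw [h2]; gcongr
      _ = _ := by rw [mul_pow]
  · obtain ⟨ν, hν, hzν⟩ := hs.surjOn ⟨μ, hμ, rfl⟩
    refine ⟨ν, by simpa using hν, ?_⟩
    rw [dist_pi_le_iff hη.le]
    intro i
    rw [dist_eq_norm]
    refine (EuclideanSpace.norm_le_card_mul (r := h) _ fun l => ?_).trans ?_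
    · have h1 : ⌊μ i l / h⌋ = ⌊ν i l / h⌋ := (congrFun (congrFun hzν i) l).symm
      have h2 := Int.abs_sub_lt_one_of_floor_eq_floor h1
      rw [← sub_div, abs_div, abs_of_pos hh0, div_lt_one hh0] at h2
      exact h2.le
    · rw [Fintype.card_fin, hh, mul_div_assoc', div_le_iff₀ (by positivity)]
      nlinarith

/-! ### Brackets and nets for the class of cell indicators -/

lemma measurableSet_voronoiCell {k d : ℕ} (μ : Fin k → EuclideanSpace ℝ (Fin d)) (j : Fin k) :
    MeasurableSet (voronoiCell μ j) := by
  have h : voronoiCell μ j = (⋂ l, {x | dist x (μ j) ≤ dist x (μ l)}) ∩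
      ⋂ l, ⋂ (_ : l < j), {x | dist x (μ j) < dist x (μ l)} := by
    ext x
    simp [voronoiCell]
  rw [h]
  refine (MeasurableSet.iInter fun l => measurableSet_le (by fun_prop) (by fun_prop)).inter
    (MeasurableSet.iInter fun l => MeasurableSet.iInter fun _ =>
      measurableSet_lt (by fun_prop) (by fun_prop))

lemma measurable_cellIndicator {k d : ℕ} (μ : Fin k → EuclideanSpace ℝ (Fin d)) :
    Measurable (cellIndicator μ) := by
  classical
  refine (WithLp.measurable_toLp 2 _).comp (measurable_pi_lambda _ fun l => ?_)
  exact Measurable.ite (measurableSet_voronoiCell _ _) measurable_const measurable_const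

lemma norm_cellIndicator_le {k d : ℕ} (μ : Fin k → EuclideanSpace ℝ (Fin d))
    (x : EuclideanSpace ℝ (Fin d)) : ‖cellIndicator μ x‖ ≤ k := by
  refine (EuclideanSpace.norm_le_card_mul (r := 1) _ fun l => ?_).trans ?_
  · simp only [cellIndicator]
    split_ifs <;> simp
  · rw [Fintype.card_fin, mul_one]
    exact_mod_cast Nat.sub_le k 1

lemma norm_cellIndicator_sub_le {k d : ℕ} {μ ν : Fin k → EuclideanSpace ℝ (Fin d)} {η : ℝ}
    (h : dist μ ν ≤ η) (x : EuclideanSpace ℝ (Fin d)) :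
    ‖cellIndicator μ x - cellIndicator ν x‖ ≤ (nearTies ν η).indicator (fun _ => 2 * (k : ℝ)) x := by
  by_cases hx : x ∈ nearTies ν η
  · rw [Set.indicator_of_mem hx]
    have := norm_sub_le (cellIndicator μ x) (cellIndicator ν x)
    linarith [norm_cellIndicator_le μ x, norm_cellIndicator_le ν x]
  · rw [Set.indicator_of_notMem hx, cellIndicator_eq_of_notMem_nearTies h hx, sub_self, norm_zero]

section
variable {k d : ℕ} {P : Measure (EuclideanSpace ℝ (Fin d))}
  {K : Set (Fin k → EuclideanSpace ℝ (Fin d))} {A C : ℝ}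

/-- The `q`-th net is a `2^(-q)`-net of centers, and the bracket half-width is a multiple of the
indicator of the near-tie set at that scale. -/
lemma nonempty_bracketSystem_cellClass (hA : 0 < A) (hC : 0 ≤ C)
    (hnet : ∀ η : ℝ, 0 < η → η ≤ 1 → ∃ s : Finset (Fin k → EuclideanSpace ℝ (Fin d)),
      ↑s ⊆ K ∧ (s.card : ℝ) ≤ A * (1 / η) ^ (k * d) ∧ ∀ μ ∈ K, ∃ ν ∈ s, dist μ ν ≤ η)
    (hties : ∀ ν ∈ K, ∀ η : ℝ, 0 ≤ η → P.real (nearTies ν η) ≤ C * η) :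
    Nonempty (BracketSystem P (cellClass K)) := by
  choose s hsK hcard hs using fun q : ℕ => hnet ((1 / 2) ^ q) (by positivity)
    (pow_le_one₀ (by norm_num) (by norm_num))
  -- Different centers can give the same function, so a representative is fixed for each member of
  -- the class.
  choose rep hrep hrep' using fun f : cellClass K => f.2
  choose near hnear hdist using fun (q : ℕ) (f : cellClass K) => hs q (rep f) (hrep f)
  have hval : ∀ f : cellClass K, f.1 = cellIndicator (rep f) := fun f => (hrep' f).symm
  refine ⟨{
    N := fun q => (s q).card
    center := fun q i => ⟨cellIndicator ((s q).equivFin.symm i).1,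
      _, hsK q ((s q).equivFin.symm i).2, rfl⟩
    proj := fun q f => (s q).equivFin ⟨near q f, hnear q f⟩
    width := fun q i => (nearTies ((s q).equivFin.symm i).1 ((1 / 2) ^ q)).indicator
      fun _ => 2 * (k : ℝ)
    B := 2 * k
    C := 2 * k * C
    -- Indeed `A * 2^(kdq) ≤ exp (A + kdq)`, which is at most `exp (κ (q + 1))`.
    κ := A + k * d
    B_nonneg := by positivity
    C_nonneg := by positivity
    κ_nonneg := by positivity
    N_le := fun q => ?_
    measurable := fun f => ?_
    norm_le := fun f x => ?_
    measurable_width := fun q i => measurable_const.indicator (measurableSet_nearTies _ _)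
    width_nonneg := fun q i x => Set.indicator_nonneg (fun _ _ => by positivity) x
    width_le := fun q i x => Set.indicator_apply_le' (fun _ => le_rfl) fun _ => by positivity
    integral_width_le := fun q i => ?_
    norm_sub_le := fun q f x => ?_ }⟩
  · refine (hcard q).trans ?_
    have h1 : (1 / (1 / 2 : ℝ) ^ q) ^ (k * d) ≤ Real.exp (k * d * q) := by
      rw [one_div, ← inv_pow, ← pow_mul, show (k * d * q : ℝ) = ((q * (k * d) : ℕ) : ℝ) * 1 by
        push_cast; ring, Real.exp_nat_mul]
      gcongr
      have := Real.add_one_le_exp 1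
      norm_num at this ⊢
      linarith
    have h2 : A ≤ Real.exp A := by linarith [Real.add_one_le_exp A]
    calc A * (1 / (1 / 2 : ℝ) ^ q) ^ (k * d) ≤ Real.exp A * Real.exp (k * d * q) := by gcongr
      _ = Real.exp (A + k * d * q) := (Real.exp_add _ _).symm
      _ ≤ _ := by
        refine Real.exp_le_exp.2 ?_
        have h3 : 0 ≤ A * q := by positivity
        have h4 : (0 : ℝ) ≤ k * d := by positivity
        linarith
  · rw [hval]
    exact measurable_cellIndicator _
  · rw [hval]
    have := norm_cellIndicator_le (rep f) x
    have : (0 : ℝ) ≤ k := k.cast_nonneg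
    linarith
  · rw [integral_indicator_const _ (measurableSet_nearTies _ _), smul_eq_mul]
    have := hties _ (hsK q ((s q).equivFin.symm i).2) ((1 / 2) ^ q) (by positivity)
    calc _ ≤ C * (1 / 2) ^ q * (2 * k) := by gcongr
      _ = _ := by ring
  · simp only [Equiv.symm_apply_apply]
    rw [hval]
    exact norm_cellIndicator_sub_le (hdist q f) x

variable [IsProbabilityMeasure P]

lemma memLp_cellIndicator (μ : Fin k → EuclideanSpace ℝ (Fin d)) :
    MemLp (cellIndicator μ) 2 P :=
  MemLp.of_bound (measurable_cellIndicator μ).aestronglyMeasurable k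
    (ae_of_all _ (norm_cellIndicator_le μ))

lemma norm_toLp_cellIndicator_sub_sq_le {μ ν : Fin k → EuclideanSpace ℝ (Fin d)} {η : ℝ}
    (h : dist μ ν ≤ η) :
    ‖(memLp_cellIndicator (P := P) μ).toLp - (memLp_cellIndicator (P := P) ν).toLp‖ ^ 2 ≤
      (2 * k) ^ 2 * P.real (nearTies ν η) := by
  rw [← MemLp.toLp_sub, ← real_inner_self_eq_norm_sq, L2.inner_def]
  have hi : Integrable ((nearTies ν η).indicator fun _ => (2 * (k : ℝ)) ^ 2) P :=
    (integrable_const _).indicator (measurableSet_nearTies _ _)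
  refine (integral_mono_of_nonneg (ae_of_all _ fun x => real_inner_self_nonneg) hi ?_).trans_eq ?_
  · filter_upwards [MemLp.coeFn_toLp ((memLp_cellIndicator (P := P) μ).sub
      (memLp_cellIndicator (P := P) ν))] with x hx
    rw [hx, real_inner_self_eq_norm_sq, Pi.sub_apply]
    refine (pow_le_pow_left₀ (norm_nonneg _) (norm_cellIndicator_sub_le h x) 2).trans_eq ?_
    by_cases hx : x ∈ nearTies ν η <;> simp [hx]
  · rw [integral_indicator_const _ (measurableSet_nearTies _ _), smul_eq_mul, mul_comm]

lemma exists_l2CoveringNumber_cellClass_le (hA : 0 < A) (hC : 0 ≤ C)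
    (hnet : ∀ η : ℝ, 0 < η → η ≤ 1 → ∃ s : Finset (Fin k → EuclideanSpace ℝ (Fin d)),
      ↑s ⊆ K ∧ (s.card : ℝ) ≤ A * (1 / η) ^ (k * d) ∧ ∀ μ ∈ K, ∃ ν ∈ s, dist μ ν ≤ η)
    (hties : ∀ ν ∈ K, ∀ η : ℝ, 0 ≤ η → P.real (nearTies ν η) ≤ C * η) :
    ∃ A : ℝ, 0 < A ∧ ∀ ε : ℝ≥0, 0 < ε → ε ≤ 1 →
      (l2CoveringNumber P (cellClass K) ε : ℝ≥0∞) ≤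
        ENNReal.ofReal (A * (1 / (ε : ℝ)) ^ (2 * k * d)) := by
  classical
  -- With centers `ε² / D` apart, the squared `L²` distance is at most `ε²`. The added `1` makes `D
  -- ≥ 1`, so that this scale is admissible for the net.
  set D : ℝ := (2 * k) ^ 2 * C + 1 with hD
  have hD1 : 1 ≤ D := by
    have : 0 ≤ (2 * (k : ℝ)) ^ 2 * C := by positivity
    linarith
  have hD0 : 0 < D := by linarith
  refine ⟨A * D ^ (k * d), by positivity, fun ε hε hε1 => ?_⟩
  have hε' : (0 : ℝ) < ε := by exact_mod_cast hε
  have hε1' : (ε : ℝ) ≤ 1 := by exact_mod_cast hε1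
  have hη0 : 0 < (ε : ℝ) ^ 2 / D := by positivity
  obtain ⟨s, hsK, hcard, hs⟩ := hnet ((ε : ℝ) ^ 2 / D) hη0 (by
    rw [div_le_one hD0]
    exact (pow_le_one₀ hε'.le hε1').trans hD1)
  set T : Finset (Lp (EuclideanSpace ℝ (Fin (k - 1))) 2 P) :=
    s.image fun ν => (memLp_cellIndicator (P := P) ν).toLp with hT
  have hcover : l2CoveringNumber P (cellClass K) ε ≤
      (T : Set (Lp (EuclideanSpace ℝ (Fin (k - 1))) 2 P)).encard := by
    refine Metric.IsCover.coveringNumber_le_encard ?_ ?_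
    · intro g hg
      obtain ⟨ν, hν, rfl⟩ := Finset.mem_image.1 (Finset.mem_coe.1 hg)
      exact ⟨cellIndicator ν, ⟨ν, hsK hν, rfl⟩, MemLp.coeFn_toLp _⟩
    · rw [Metric.isCover_iff_subset_iUnion_closedBall]
      rintro g ⟨_, ⟨μ, hμ, rfl⟩, hg⟩
      obtain ⟨ν, hν, hdist⟩ := hs μ hμ
      have hg' : g = (memLp_cellIndicator (P := P) μ).toLp :=
        Lp.ext (hg.trans (MemLp.coeFn_toLp _).symm)
      refine Set.mem_iUnion₂.2 ⟨_, Finset.mem_coe.2 (Finset.mem_image_of_mem _ hν), ?_⟩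
      rw [Metric.mem_closedBall, dist_eq_norm, hg']
      refine le_of_sq_le_sq ?_ hε'.le
      refine (norm_toLp_cellIndicator_sub_sq_le hdist).trans ?_
      calc (2 * (k : ℝ)) ^ 2 * P.real (nearTies ν ((ε : ℝ) ^ 2 / D))
          ≤ (2 * k) ^ 2 * (C * ((ε : ℝ) ^ 2 / D)) := by
            gcongr
            exact hties ν (hsK hν) _ hη0.le
        _ = ((2 * k) ^ 2 * C / D) * (ε : ℝ) ^ 2 := by ring
        _ ≤ 1 * (ε : ℝ) ^ 2 := by
            gcongr
            rw [div_le_one hD0]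
            linarith
        _ = _ := one_mul _
  have hcardT : (T.card : ℝ) ≤ A * D ^ (k * d) * (1 / (ε : ℝ)) ^ (2 * k * d) := by
    have h1 : (T.card : ℝ) ≤ s.card := by exact_mod_cast Finset.card_image_le
    refine h1.trans (hcard.trans (le_of_eq ?_))
    rw [show 1 / ((ε : ℝ) ^ 2 / D) = D * (1 / ε) ^ 2 by field_simp, mul_pow, ← pow_mul,
      mul_assoc, mul_assoc 2]
  calc (l2CoveringNumber P (cellClass K) ε : ℝ≥0∞)
      ≤ ((T : Set (Lp (EuclideanSpace ℝ (Fin (k - 1))) 2 P)).encard : ℝ≥0∞) := by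
        exact_mod_cast hcover
    _ = (T.card : ℝ≥0∞) := by simp
    _ = ENNReal.ofReal T.card := by simp
    _ ≤ _ := ENNReal.ofReal_le_ofReal hcardT

end

/-! ### Separation of the centers and proof of the theorem. -/

lemma exists_pos_le_dist_of_injective {ι E : Type*} [Finite ι] [MetricSpace E] {f : ι → E}
    (hf : Function.Injective f) : ∃ r : ℝ, 0 < r ∧ ∀ i j, i ≠ j → r ≤ dist (f i) (f j) := by
  rcases isEmpty_or_nonempty {p : ι × ι // p.1 ≠ p.2} with h | h
  · exact ⟨1, one_pos, fun i j hij => (h.false ⟨(i, j), hij⟩).elim⟩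
  · obtain ⟨p, hp⟩ := Finite.exists_min
      fun p : {p : ι × ι // p.1 ≠ p.2} => dist (f p.1.1) (f p.1.2)
    exact ⟨_, dist_pos.2 fun h => p.2 (hf h), fun i j hij => hp ⟨(i, j), hij⟩⟩

theorem lemma1 {k d : ℕ} (hk : 1 ≤ k) (hd : 1 ≤ d)
    (P : Measure (EuclideanSpace ℝ (Fin d))) [IsProbabilityMeasure P]
    (hsupp : Bornology.IsBounded P.support)
    (p : EuclideanSpace ℝ (Fin d) → ℝ) (hp_nonneg : ∀ x, 0 ≤ p x) (hp_cont : Continuous p)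
    (hp_bdd : ∃ M : ℝ, ∀ x, p x ≤ M)
    (hP : P = volume.withDensity fun x => ENNReal.ofReal (p x))
    (μstar : Fin k → EuclideanSpace ℝ (Fin d)) (hμstar : IsUniqueKMeansSolution P μstar) :
    ∃ δ : ℝ, 0 < δ ∧
      ∀ K : Set (Fin k → EuclideanSpace ℝ (Fin d)),
        IsCompact K → K ∈ 𝓝 μstar → Metric.diam K ≤ δ →
        IsDonsker P (cellClass K) ∧
        ∃ A : ℝ, 0 < A ∧ ∀ ε : ℝ≥0, 0 < ε → ε ≤ 1 →
          (l2CoveringNumber P (cellClass K) ε : ℝ≥0∞) ≤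
            ENNReal.ofReal (A * (1 / (ε : ℝ)) ^ (2 * k * d)) := by
  obtain ⟨M, hM⟩ := hp_bdd
  obtain ⟨R, hR, hPR⟩ := ae_norm_le_of_isBounded_support hsupp
  obtain ⟨r, hr, hsep⟩ := exists_pos_le_dist_of_injective (hμstar.injective hd hPR)
  -- In the sup metric each center moves by at most `r / 4` from its optimal position, so that two
  -- centers remain at least `r / 2` apart.
  refine ⟨r / 4, by positivity, fun K hK hKn hdiam => ?_⟩
  have hclose : ∀ μ ∈ K, ∀ i, dist (μ i) (μstar i) ≤ r / 4 := fun μ hμ i =>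
    ((dist_le_pi_dist μ μstar i).trans
      (Metric.dist_le_diam_of_mem hK.isBounded hμ (mem_of_mem_nhds hKn))).trans hdiam
  have hsepK : ∀ μ ∈ K, ∀ i j, i ≠ j → r / 2 ≤ dist (μ i) (μ j) := fun μ hμ i j hij => by
    have h1 := hsep i j hij
    have h2 := dist_triangle4 (μstar i) (μ i) (μ j) (μstar j)
    rw [dist_comm (μstar i) (μ i)] at h2
    linarith [hclose μ hμ i, hclose μ hμ j]
  obtain ⟨R', hR', hKR⟩ := hK.isBounded.exists_pos_norm_le
  have hKR' : ∀ μ ∈ K, ∀ i, ‖μ i‖ ≤ max R R' := fun μ hμ i =>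
    ((norm_le_pi_norm μ i).trans (hKR μ hμ)).trans (le_max_right _ _)
  have hRR : 0 < max R R' := lt_max_of_lt_left hR
  obtain ⟨A, hA, hnet⟩ := exists_net hRR hKR'
  obtain ⟨C, hC, hties⟩ := exists_measure_nearTies_le (k := k) hM
    ((hp_nonneg 0).trans (hM 0)) hP (half_pos hr) hRR
    (hPR.mono fun x hx => hx.trans (le_max_left _ _))
  have hties' : ∀ ν ∈ K, ∀ η : ℝ, 0 ≤ η → P.real (nearTies ν η) ≤ C * η :=
    fun ν hν => hties ν (hKR' ν hν) (hsepK ν hν)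
  obtain ⟨b⟩ := nonempty_bracketSystem_cellClass hA hC hnet hties'
  exact ⟨b.isDonsker, exists_l2CoveringNumber_cellClass_le hA hC hnet hties'⟩
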